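/- Let $SU(2)\cong S^3$ carry the round metric of the sphere of radius $2$, with volume measure $\mu$ (the bi-invariant measure of total mass $16\pi^2$) and $\|F\|^2=\int|F|^2d\mu$. Write $h(\alpha,\beta)=\begin{pmatrix}\alpha&-\bar\beta\\ \beta&\bar\alpha\end{pmatrix}$ and $g_3(\psi)=\mathrm{diag}(e^{i\psi/2},e^{-i\psi/2})$. For $\ell\in\frac12\mathbb N$ and $m,s\in\{-\ell,-\ell+1,\dots,\ell\}$ let $D^\ell_{m,s}$ be the Wigner functions on $SU(2)$, defined by $$\sum_{m}\tbinom{2\ell}{\ell+m}^{1/2}z_0^{\ell+m}z_1^{\ell-m}D^\ell_{m,s}(h(\alpha,\beta))=\tbinom{2\ell}{\ell+s}^{1/2}(\bar\alpha z_0+\bar\beta z_1)^{\ell+s}(-\beta z_0+\alpha z_1)^{\ell-s},$$ and put $\phi^\ell_{m,s}=\frac{\sqrt{2\ell+1}}{4\pi}D^\ell_{m,s}$. A function has degree $2\ell$ if it lies in $\mathscr D^\ell=\mathrm{span}_{\mathbb C}\{D^\ell_{m,s}\}_{m,s}$. A random spin weighted function of spin weight $s$ is a jointly measurable random field on $SU(2)$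 which is almost surely smooth with $F(g\,g_3(\psi))=F(g)e^{-is\psi}$ for all $g,\psi$. Let $X\colon\Omega\times SU(2)\to\mathbb C$ be a jointly measurable random field on a probability space $(\Omega,\mathbb P)$, and put $$a^\ell_{m,s}=\int X\,\overline{\phi^\ell_{m,s}}\,d\mu,\qquad X^\ell=\sum_{m,s}a^\ell_{m,s}\phi^\ell_{m,s},\qquad X^\ell_{\bullet,s}=\sum_m a^\ell_{m,s}\phi^\ell_{m,s}.$$ $X$ is bi-invariant if $X(a^{-1}\,\cdot\,b)$ and $X$ have the same finite-dimensional distributions for all $a,b\in SU(2)$. It is $2$-weakly bi-invariant if $\mathbb E|X(g)|^2<\infty$ for all $g$ and $X(a\,\cdot\,b)$ and $X$ have the same joint moments of order at most two (complex conjugates included) for all $a,b\in SU(2)$. The strong spectral probability $\mathbb E\,\mathrm{TS}_X$ gives mass $\mathbb E\big(|a^\ell_{m,s}|^2/\|X\|^2\big)$ to $(\ell,m,s)$, with $0/0=0$; the weak one, $\mathrm{TSE}_X$, gives mass $\mathbb E|a^\ell_{m,s}|^2/\mathbb E\|X\|^2$. Their images under $(\ell,m,s)\mapsto(m,s)$ are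 $\mathbb E\,\mathrm{BS}_X$ and $\mathrm{BSE}_X$, and the image of $\mathbb E\,\mathrm{TS}_X$ under $(\ell,m,s)\mapsto s$ is the expected right-spin probability $\mathbb E\,\mathrm{RS}_X$. 1. Let $X$ be bi-invariant and almost surely of degree $2\ell$. Then (a) for every $s\in\{-\ell,\dots,\ell\}$ the field $X^\ell_{\bullet,s}$ is a random spin weighted function of spin weight $s$; almost surely $X=\sum_s X^\ell_{\bullet,s}$; and, unless $X=0$ almost surely, none of the $X^\ell_{\bullet,s}$ is almost surely zero; (b) if $\mathbb E\|X\|^2<\infty$ and $s'\notin\{s,-s\}$, then $X^\ell_{\bullet,s}$ and $X^\ell_{\bullet,s'}$ are uncorrelated: for all $g,h$, both $X^\ell_{\bullet,s}(g)$ and its complex conjugate have zero covariance with $X^\ell_{\bullet,s'}(h)$; (c) $\mathbb E\,\mathrm{RS}_X$ equals $\mathbb P(X\ne0)$ times the uniform probability on $\{-\ell,\dots,\ell\}$, and $\mathbb E\,\mathrm{TS}_X$ equals $\mathbb P(X\neq 0)$ times the uniform probability on $\{\ell\}\times\{-\ell,\dots,\ell\}^2$ (so they are the uniform probabilities if $X\ne0$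 almost surely); if $\mathbb E\|X\|^2<\infty$ and $X$ is not almost surely zero, then $\mathrm{TSE}_X$ is the uniform probability on $\{\ell\}\times\{-\ell,\dots,\ell\}^2$. 2. If $X$ is $2$-weakly bi-invariant, then $\mathrm{TSE}_X$ is uniform on each set $\{\ell\}\times\{-\ell,\dots,\ell\}^2$, $\ell\in\frac12\mathbb N$; and, for each $\ell$ such that $X^\ell$ is not almost surely zero, $\mathrm{BSE}_{X^\ell}$ is the uniform probability on $\{-\ell,\dots,\ell\}^2$. 3. If $X$ is bi-invariant and almost surely in $L^2(SU(2))$, then $\mathbb E\,\mathrm{TS}_X$ is uniform on each set $\{\ell\}\times\{-\ell,\dots,\ell\}^2$; and for each $\ell$, $\mathbb E\,\mathrm{BS}_{X^\ell}$ equals $\mathbb P(X^\ell\neq0)$ times the uniform probability on $\{-\ell,\dots,\ell\}^2$. Here a measure is uniform on a finite set if all points of the set have equal mass. -/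

import Mathlib

open MeasureTheory ProbabilityTheory
open scoped ENNReal ComplexConjugate

/-! ### The group `SU(2)` as the round sphere of radius two -/

/-- The group `SU(2)`; its elements are the matrices `h(α, β)` with first column `(α, β)`, second
column `(-conj β, conj α)` and `|α|² + |β|² = 1`. -/
abbrev SU2 : Type := ↥(Matrix.specialUnitaryGroup (Fin 2) ℂ)

instance SU2.instIsTopologicalGroup : IsTopologicalGroup SU2 where
  continuous_mul := by
    refine Continuous.subtype_mk ?_ _
    exact (continuous_subtype_val.comp continuous_fst).mul
      (continuous_subtype_val.comp continuous_snd)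
  continuous_inv := by
    refine Continuous.subtype_mk (f := fun g : SU2 => star (g : Matrix (Fin 2) (Fin 2) ℂ)) ?_ _
    exact continuous_star.comp continuous_subtype_val

noncomputable section

instance SU2.instCompactSpace : CompactSpace SU2 := by
  refine (isCompact_iff_compactSpace (s := ((Matrix.specialUnitaryGroup (Fin 2) ℂ :
    Submonoid (Matrix (Fin 2) (Fin 2) ℂ)) : Set (Matrix (Fin 2) (Fin 2) ℂ)))).mp ?_
  have hbox : IsCompact (Set.pi Set.univ (fun _ : Fin 2 => Set.pi Set.univ
      (fun _ : Fin 2 => Metric.closedBall (0 : ℂ) 1))) :=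
    isCompact_univ_pi fun _ => isCompact_univ_pi fun _ => isCompact_closedBall _ _
  refine IsCompact.of_isClosed_subset (X := Matrix (Fin 2) (Fin 2) ℂ) hbox ?_ ?_
  · have : ((Matrix.specialUnitaryGroup (Fin 2) ℂ : Set (Matrix (Fin 2) (Fin 2) ℂ)))
        = {A | A * star A = 1} ∩ {A | A.det = 1} := by
      ext A
      simp [Matrix.mem_specialUnitaryGroup_iff, Matrix.mem_unitaryGroup_iff]
    rw [this]
    exact (isClosed_eq (continuous_id.mul continuous_star) continuous_const).inter
      (isClosed_eq (Continuous.matrix_det continuous_id) continuous_const)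
  · intro A hA i _ j _
    have := entry_norm_bound_of_unitary (Matrix.specialUnitaryGroup_le_unitaryGroup hA) i j
    simpa using this

instance SU2.instMeasurableSpace : MeasurableSpace SU2 := borel SU2

instance SU2.instBorelSpace : BorelSpace SU2 := ⟨rfl⟩

/-- The Riemannian volume of `SU(2)` with the round metric of the sphere of radius `2`: the
bi-invariant measure of total mass `16 π²`. -/
def SU2.vol : Measure SU2 :=
  ENNReal.ofReal (16 * Real.pi ^ 2) • Measure.haarMeasure ⊤

/-- The one-parameter subgroup `g₃(ψ) = diag(exp(iψ/2), exp(-iψ/2))`. -/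
def SU2.g3 (ψ : ℝ) : SU2 :=
  ⟨!![Complex.exp (Complex.I * ψ / 2), 0; 0, Complex.exp (-(Complex.I * ψ / 2))], by
    have hc : ∀ z : ℂ, conj (Complex.exp z) = Complex.exp (conj z) :=
      fun z => (Complex.exp_conj z).symm
    rw [Matrix.mem_specialUnitaryGroup_iff, Matrix.mem_unitaryGroup_iff]
    constructor
    · ext i j
      fin_cases i <;> fin_cases j <;>
        simp [Matrix.mul_apply, Fin.sum_univ_two, Matrix.star_apply, hc, ← Complex.exp_add,
          neg_div, Complex.conj_ofNat]
    · simp [Matrix.det_fin_two, ← Complex.exp_add]⟩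

/-- The squared norm of `F` in `L²(SU(2))`, with values in `[0, ∞]`. -/
def l2NormSq (F : SU2 → ℂ) : ℝ≥0∞ := ∫⁻ g, ‖F g‖ₑ ^ 2 ∂SU2.vol

/-! ### Functions of pure spin -/

/-- Smoothness of a function on `SU(2)`, the unit sphere of `ℂ²` in the coordinates `(α, β)`: it
extends to a smooth function on the ambient space. -/
def SU2.IsSmooth (F : SU2 → ℂ) : Prop :=
  ∃ G : ℂ × ℂ → ℂ, ContDiff ℝ ((⊤ : ℕ∞) : WithTop ℕ∞) G ∧ ∀ g : SU2, F g = G (g.1 0 0, g.1 1 0)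

/-- The smooth functions of right spin `r`: `F(g · g₃(ψ)) = F(g) exp(i r ψ)`. -/
def rightSpinFunctions (r : ℚ) : Set (SU2 → ℂ) :=
  {F | SU2.IsSmooth F ∧
    ∀ (g : SU2) (ψ : ℝ), F (g * SU2.g3 ψ) = F g * Complex.exp (Complex.I * (r : ℂ) * ψ)}

/-! ### Wigner functions

A half-integer `ℓ` is encoded by `n = 2ℓ`, and an index `m ∈ {-ℓ, …, ℓ}` by the number
`i = ℓ + m ∈ {0, …, n}`. -/

/-- The half-integer `m = i - ℓ` encoded by `i ∈ {0, …, 2ℓ}`, for `n = 2ℓ`. -/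
def spinValue (n : ℕ) (i : Fin (n + 1)) : ℚ := (i : ℕ) - (n : ℚ) / 2

/-- The set `{-ℓ, -ℓ + 1, …, ℓ}`, for `n = 2ℓ`. -/
def spinSet (n : ℕ) : Set ℚ := Set.range (spinValue n)

/-- The Wigner function `D^ℓ_{m,s}` for `n = 2ℓ`, `i = ℓ + m`, `j = ℓ + s`. With
`ψ_m(z₀, z₁) = (2ℓ choose ℓ+m)^(1/2) z₀^(ℓ+m) z₁^(ℓ-m)`, it is defined by
`∑ m, ψ_m(z) D^ℓ_{m,s}(g) = ψ_s(g⁻¹ z)`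
`= (2ℓ choose ℓ+s)^(1/2) (conj α z₀ + conj β z₁)^(ℓ+s) (-β z₀ + α z₁)^(ℓ-s)`;
below, `z₀` is the polynomial variable and `z₁ = 1`. -/
def wignerD (n : ℕ) (i j : Fin (n + 1)) (g : SU2) : ℂ :=
  (Real.sqrt (n.choose j) / Real.sqrt (n.choose i) : ℝ) *
    ((Polynomial.C (conj (g.1 0 0)) * Polynomial.X + Polynomial.C (conj (g.1 1 0))) ^ (j : ℕ) *
      (Polynomial.C (-(g.1 1 0)) * Polynomial.X + Polynomial.C (g.1 0 0)) ^ (n - (j : ℕ))).coeff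
      (i : ℕ)

/-- The hyperspherical harmonic `φ^ℓ_{m,s} = (2ℓ+1)^(1/2) / (4π) · D^ℓ_{m,s}`. -/
def wignerPhi (n : ℕ) (i j : Fin (n + 1)) (g : SU2) : ℂ :=
  (Real.sqrt (n + 1) / (4 * Real.pi) : ℝ) * wignerD n i j g

/-- The space `𝒟^ℓ` of functions of degree `2ℓ`, spanned by the `D^ℓ_{m,s}`, for `n = 2ℓ`. -/
def wignerSpace (n : ℕ) : Submodule ℂ (SU2 → ℂ) :=
  Submodule.span ℂ (Set.range fun p : Fin (n + 1) × Fin (n + 1) => wignerD n p.1 p.2)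

/-- The Fourier coefficient `a^ℓ_{m,s} = ⟨φ^ℓ_{m,s}, F⟩` in `L²(SU(2))`. -/
def fourierCoef (F : SU2 → ℂ) (n : ℕ) (i j : Fin (n + 1)) : ℂ :=
  ∫ g, F g * conj (wignerPhi n i j g) ∂SU2.vol

/-- The component `X^ℓ = ∑ m s, a^ℓ_{m,s} φ^ℓ_{m,s}` of degree `2ℓ` of a random field. -/
def degreePart {Ω : Type*} (X : Ω → SU2 → ℂ) (n : ℕ) : Ω → SU2 → ℂ :=
  fun ω g => ∑ i, ∑ j, fourierCoef (X ω) n i j * wignerPhi n i j g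

/-- The component `X^ℓ_{•,s} = ∑ m, a^ℓ_{m,s} φ^ℓ_{m,s}` of a random field, `j = ℓ + s`. -/
def columnPart {Ω : Type*} (X : Ω → SU2 → ℂ) (n : ℕ) (j : Fin (n + 1)) : Ω → SU2 → ℂ :=
  fun ω g => ∑ i, fourierCoef (X ω) n i j * wignerPhi n i j g

/-! ### Random fields -/

section RandomFields

variable {Ω : Type*} [MeasurableSpace Ω]

/-- A random spin weighted function of spin weight `s`, as a random field on `SU(2)`: almost
surely it is a smooth function of right spin `-s`, i.e. the pull-back of a section of the spin `s`
bundle over the two-sphere. -/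
def IsRandomSpinWeighted (P : Measure Ω) (s : ℚ) (Y : Ω → SU2 → ℂ) : Prop :=
  Measurable (Function.uncurry Y) ∧ ∀ᵐ ω ∂P, Y ω ∈ rightSpinFunctions (-s)

/-- Bi-invariance in law: for all `a, b` the fields `X(a⁻¹ · b)` and `X` have the same law on
`ℂ^SU(2)` with the product σ-algebra, i.e. the same finite-dimensional distributions. -/
def IsBiInvariant (P : Measure Ω) (X : Ω → SU2 → ℂ) : Prop :=
  ∀ a b : SU2, IdentDistrib (fun ω (g : SU2) => X ω (a⁻¹ * g * b)) X P P

/-- `2`-weak bi-invariance: the variables `X(g)` have finite second moments, and `X(a · b)` and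
`X` have the same joint moments of order at most two, complex conjugates included. -/
structure IsTwoWeaklyBiInvariant (P : Measure Ω) (X : Ω → SU2 → ℂ) : Prop where
  memLp : ∀ g, MemLp (fun ω => X ω g) 2 P
  mean : ∀ a b g : SU2, ∫ ω, X ω (a * g * b) ∂P = ∫ ω, X ω g ∂P
  corr : ∀ a b g h : SU2,
    ∫ ω, X ω (a * g * b) * X ω (a * h * b) ∂P = ∫ ω, X ω g * X ω h ∂P
  corr_conj : ∀ a b g h : SU2,
    ∫ ω, conj (X ω (a * g * b)) * X ω (a * h * b) ∂P = ∫ ω, conj (X ω g) * X ω h ∂P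

/-- Two complex random fields with finite second moments are uncorrelated: the covariance of
`Y(g)` and of `conj Y(g)` with `Z(h)` vanishes for all `g, h`. -/
structure AreUncorrelated (P : Measure Ω) (Y Z : Ω → SU2 → ℂ) : Prop where
  memLp_left : ∀ g, MemLp (fun ω => Y ω g) 2 P
  memLp_right : ∀ h, MemLp (fun ω => Z ω h) 2 P
  cov : ∀ g h : SU2,
    ∫ ω, Y ω g * Z ω h ∂P = (∫ ω, Y ω g ∂P) * ∫ ω, Z ω h ∂P
  cov_conj : ∀ g h : SU2,
    ∫ ω, conj (Y ω g) * Z ω h ∂P = (∫ ω, conj (Y ω g) ∂P) * ∫ ω, Z ω h ∂P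

end RandomFields

/-! ### Spectral probabilities -/

/-- The set of all triples `(ℓ, m, s)`, encoded as `(2ℓ, ℓ + m, ℓ + s)`. -/
def WignerIndex : Type := Σ n : ℕ, Fin (n + 1) × Fin (n + 1)

instance WignerIndex.instMeasurableSpace : MeasurableSpace WignerIndex := ⊤

/-- The set `{ℓ} × {-ℓ, …, ℓ} × {-ℓ, …, ℓ}`, for `n = 2ℓ`. -/
def WignerIndex.level (n : ℕ) : Set WignerIndex := {k | k.1 = n}

/-- The component `s` of `(ℓ, m, s)`. -/
def WignerIndex.right (k : WignerIndex) : ℚ := spinValue k.1 k.2.2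

/-- The component `(m, s)` of `(ℓ, m, s)`. -/
def WignerIndex.both (k : WignerIndex) : ℚ × ℚ := (spinValue k.1 k.2.1, spinValue k.1 k.2.2)

/-- The spectral probability of `F`: the mass of `(ℓ, m, s)` is `|a^ℓ_{m,s}|² / ‖F‖²`
(with `0 / 0 = 0` if `F = 0`). -/
def spectralMeasure (F : SU2 → ℂ) : Measure WignerIndex :=
  Measure.sum fun k : WignerIndex =>
    (‖fourierCoef F k.1 k.2.1 k.2.2‖ₑ ^ 2 / l2NormSq F) • Measure.dirac k

/-- The right spin of `F`: the mass of `s` is `∑ ℓ m, |a^ℓ_{m,s}|² / ‖F‖²`. -/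
def rightSpinMeasure (F : SU2 → ℂ) : Measure ℚ := (spectralMeasure F).map WignerIndex.right

/-- The bi-spin of `F`: the mass of `(m, s)` is `∑ ℓ, |a^ℓ_{m,s}|² / ‖F‖²`. -/
def biSpinMeasure (F : SU2 → ℂ) : Measure (ℚ × ℚ) := (spectralMeasure F).map WignerIndex.both

section RandomSpectra

variable {Ω : Type*} [MeasurableSpace Ω]

/-- The expectation of a random measure on a countable discrete space: the mass of `{k}` is the
expectation of the random mass of `{k}`. -/
def expectedMeasure {ι : Type*} [MeasurableSpace ι] (P : Measure Ω) (ν : Ω → Measure ι) :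
    Measure ι :=
  Measure.sum fun k : ι => (∫⁻ ω, ν ω {k} ∂P) • Measure.dirac k

/-- The weak spectral probability: the mass of `(ℓ, m, s)` is `E |a^ℓ_{m,s}|² / E ‖X‖²`. -/
def weakSpectralMeasure (P : Measure Ω) (X : Ω → SU2 → ℂ) : Measure WignerIndex :=
  Measure.sum fun k : WignerIndex =>
    ((∫⁻ ω, ‖fourierCoef (X ω) k.1 k.2.1 k.2.2‖ₑ ^ 2 ∂P) / ∫⁻ ω, l2NormSq (X ω) ∂P) •
      Measure.dirac k

/-- The weak bi-spin: the mass of `(m, s)` is `∑ ℓ, E |a^ℓ_{m,s}|² / E ‖X‖²`. -/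
def weakBiSpinMeasure (P : Measure Ω) (X : Ω → SU2 → ℂ) : Measure (ℚ × ℚ) :=
  (weakSpectralMeasure P X).map WignerIndex.both

/-- The strong spectral probability: the expectation of the spectral probability of `X`. -/
def strongSpectralMeasure (P : Measure Ω) (X : Ω → SU2 → ℂ) : Measure WignerIndex :=
  expectedMeasure P fun ω => spectralMeasure (X ω)

/-- The expected right spin of `X`. -/
def expectedRightSpin (P : Measure Ω) (X : Ω → SU2 → ℂ) : Measure ℚ :=
  expectedMeasure P fun ω => rightSpinMeasure (X ω)

/-- The expected bi-spin of `X`. -/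
def expectedBiSpin (P : Measure Ω) (X : Ω → SU2 → ℂ) : Measure (ℚ × ℚ) :=
  expectedMeasure P fun ω => biSpinMeasure (X ω)

end RandomSpectra

/-- A measure on the set of triples `(ℓ, m, s)` is uniform on each set
`{ℓ} × {-ℓ, …, ℓ} × {-ℓ, …, ℓ}`: its restriction to that set is a multiple of the uniform
probability. -/
def IsUniformOnLevels (ν : Measure WignerIndex) : Prop :=
  ∀ n : ℕ, ν.restrict (WignerIndex.level n) =
    ν (WignerIndex.level n) • uniformOn (WignerIndex.level n)

end

/-! ### Coordinates on `SU(2)` -/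

namespace SU2

/-! The Wigner functions of degree `n` are the matrix coefficients of a unitary representation of
`SU(2)` on binary forms of degree `n` (`wignerD_mul`, `wignerD_inv`). Hence translating a field on
both sides acts on its array `A` of Fourier coefficients of degree `n` by `A ↦ conj D(a) · A ·
D(b)ᵀ` (`rotate`, `fourierCoef_translate`) and leaves its norm unchanged. By Schur orthogonality
(`wignerInner_eq_ite`, `wignerInner_eq_zero_of_ne`), the mean of `|A i j|²` over an orbit is
`(n+1)⁻² ∑ |A k l|²`, which does not depend on `(i, j)` (`lintegral_enorm_rotate_sq`).

If the law of the pair (`A`, norm) is invariant under rotations, Haar averaging and Tonelli carry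
this to expectations, with any rotation invariant weight (`lintegral_entry_eq_of_rotate`). The
weights `1`, `1/‖X‖²` and `1/∑ |A k l|²` give the weak spectra, the strong spectra and the strong
spectra of one degree. The convention `0/0 = 0` is the source of the factor `P(X ≠ 0)`.

The invariance itself has to come from finite-dimensional distributions, although Fourier
coefficients depend on the whole path. Joint measurability is what helps: by the strong law of large
numbers and Fubini, some deterministic sequence of points computes the integrals of almost every
path of both fields as limits of sample means, so these integrals are one measurable function of
countably many values (`identDistrib_integral`). In the `2`-weak case no law is available; instead
the second moment of a coefficient is a double integral of the covariance function
(`memLp_fourierCoef_and_second_moment`), which translations preserve.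

Columns are uncorrelated because a right rotation by `g₃(ψ)` multiplies column `s` by `exp(-isψ)`:
an expectation that picks up a nontrivial character is zero (`integral_eq_zero_of_right_spin`). -/

instance instSecondCountableTopology : SecondCountableTopology SU2 :=
  haveI : SecondCountableTopology (Matrix (Fin 2) (Fin 2) ℂ) :=
    inferInstanceAs (SecondCountableTopology (Fin 2 → Fin 2 → ℂ))
  TopologicalSpace.Subtype.secondCountableTopology _

theorem inv_val (g : SU2) : (g⁻¹ : SU2).1 = star g.1 := rfl

theorem val_inv_eq_adjugate (g : SU2) : star g.1 = g.1.adjugate := by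
  have h := Matrix.mem_specialUnitaryGroup_iff.1 g.2
  have hu := Matrix.mem_unitaryGroup_iff'.1 h.1
  calc star g.1 = star g.1 * (g.1 * g.1.adjugate) := by
        rw [Matrix.mul_adjugate, h.2, one_smul, mul_one]
    _ = g.1.adjugate := by rw [← mul_assoc, hu, one_mul]

theorem val_one_one (g : SU2) : g.1 1 1 = conj (g.1 0 0) := by
  have := congrFun (congrFun (val_inv_eq_adjugate g) 0) 0
  simpa [Matrix.adjugate_fin_two, Matrix.star_apply] using this.symm

theorem val_zero_one (g : SU2) : g.1 0 1 = -conj (g.1 1 0) := by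
  have := congrFun (congrFun (val_inv_eq_adjugate g) 0) 1
  simp only [Matrix.adjugate_fin_two, Matrix.star_apply] at this
  simpa using (congrArg Neg.neg this).symm

theorem mul_val_zero_zero (g h : SU2) :
    (g * h).1 0 0 = g.1 0 0 * h.1 0 0 - conj (g.1 1 0) * h.1 1 0 := by
  change (g.1 * h.1) 0 0 = _
  rw [Matrix.mul_apply, Fin.sum_univ_two, val_zero_one]; ring

theorem mul_val_one_zero (g h : SU2) :
    (g * h).1 1 0 = g.1 1 0 * h.1 0 0 + conj (g.1 0 0) * h.1 1 0 := by
  change (g.1 * h.1) 1 0 = _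
  rw [Matrix.mul_apply, Fin.sum_univ_two, val_one_one]

theorem inv_val_zero_zero (g : SU2) : (g⁻¹).1 0 0 = conj (g.1 0 0) := by
  rw [inv_val, Matrix.star_apply]; rfl

theorem inv_val_one_zero (g : SU2) : (g⁻¹).1 1 0 = -(g.1 1 0) := by
  rw [inv_val, Matrix.star_apply, val_zero_one]; simp

/-- There is an element of `SU(2)` both of whose coordinates are nonzero. -/
theorem exists_val_ne_zero : ∃ h : SU2, h.1 0 0 ≠ 0 ∧ h.1 1 0 ≠ 0 := by
  have hs : (3 / 5 : ℂ) * (3 / 5) + 4 / 5 * (4 / 5) = 1 := by norm_num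
  refine ⟨⟨!![3 / 5, -(4 / 5); 4 / 5, 3 / 5], ?_⟩, by simp, by simp⟩
  rw [Matrix.mem_specialUnitaryGroup_iff, Matrix.mem_unitaryGroup_iff]
  constructor
  · ext i j
    fin_cases i <;> fin_cases j <;>
      simp [Matrix.mul_apply, Fin.sum_univ_two, Matrix.star_apply, Complex.conj_ofNat] <;> norm_num
  · simp [Matrix.det_fin_two]; norm_num

end SU2

/-! ### Powers of linear polynomials -/

section LinearPowers

open Polynomial

variable {A : Type*} [CommRing A] [Algebra ℂ A]

/-- The Wigner functions are coefficients of a form with `z₁ = 1`. Homogenizing restores the second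
variable; a general algebra `A` allows polynomials to be substituted for both variables, which is
how two group elements are composed. -/
theorem aeval_homogenize_eq_sum (p : ℂ[X]) (n : ℕ) (x y : A) :
    MvPolynomial.aeval ![x, y] (p.homogenize n) =
      ∑ i : Fin (n + 1), algebraMap ℂ A (p.coeff i) * x ^ (i : ℕ) * y ^ (n - (i : ℕ)) := by
  rw [Polynomial.homogenize, map_sum, Finset.Nat.sum_antidiagonal_eq_sum_range_succ_mk,
    Finset.sum_range]
  refine Finset.sum_congr rfl fun i _ => ?_
  rw [MvPolynomial.aeval_monomial, Finsupp.prod_fintype _ _ (by simp)]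
  simp [mul_assoc]

theorem natDegree_linear_pow_le (a b : ℂ) (j : ℕ) : ((C a * X + C b) ^ j).natDegree ≤ j := by
  simpa using natDegree_pow_le_of_le j (natDegree_linear_le (a := a) (b := b))

theorem aeval_homogenize_linear_pow (a b : ℂ) (j : ℕ) (x y : A) :
    MvPolynomial.aeval ![x, y] (((C a * X + C b) ^ j).homogenize j) =
      (algebraMap ℂ A a * x + algebraMap ℂ A b * y) ^ j := by
  induction j with
  | zero => simp
  | succ j ih =>
    rw [pow_succ, homogenize_mul _ _ (natDegree_linear_pow_le a b j) natDegree_linear_le, map_mul,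
      ih, pow_succ]
    congr 1
    rw [homogenize_add, homogenize_C_mul, homogenize_X one_ne_zero, homogenize_C]
    simp

/-- The homogeneous form of a product of powers of two linear polynomials. -/
theorem sum_coeff_linear_pow_mul (a b c d : ℂ) {n j : ℕ} (hj : j ≤ n) (x y : A) :
    ∑ i : Fin (n + 1), algebraMap ℂ A
        (((C a * X + C b) ^ j * (C c * X + C d) ^ (n - j)).coeff i) *
          x ^ (i : ℕ) * y ^ (n - (i : ℕ)) =
      (algebraMap ℂ A a * x + algebraMap ℂ A b * y) ^ j *
        (algebraMap ℂ A c * x + algebraMap ℂ A d * y) ^ (n - j) := by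
  rw [← aeval_homogenize_eq_sum]
  have h := homogenize_mul _ _ (natDegree_linear_pow_le a b j) (natDegree_linear_pow_le c d (n - j))
  rw [Nat.add_sub_cancel' hj] at h
  rw [h, map_mul, aeval_homogenize_linear_pow, aeval_homogenize_linear_pow]

theorem coeff_linear_pow (u v : ℂ) {n i : ℕ} (hi : i ≤ n) :
    ((C u * X + C v) ^ n).coeff i = u ^ i * v ^ (n - i) * n.choose i := by
  rw [add_pow, finsetSum_coeff, Finset.sum_eq_single i]
  · rw [mul_pow, ← C_pow, ← C_pow, ← C_eq_natCast]
    simp only [mul_assoc, coeff_C_mul]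
    rw [← C_mul, coeff_X_pow_mul', coeff_C]
    simp
  · intro b _ hb
    rw [mul_pow, ← C_pow, ← C_pow, ← C_eq_natCast]
    simp only [mul_assoc, coeff_C_mul]
    rw [← C_mul, coeff_X_pow_mul', coeff_C]
    have : b ≤ i → i - b ≠ 0 := by omega
    split_ifs with h1 h2
    · exact absurd h2 (this h1)
    · simp
    · simp
  · intro h; simp at h; omega

theorem coeff_sum_C_mul_X_pow (n : ℕ) (c : ℕ → ℂ) (j : ℕ) (hj : j ∈ Finset.range (n + 1)) :
    (∑ k ∈ Finset.range (n + 1), C (c k) * X ^ k).coeff j = c j := by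
  simp [coeff_C_mul, coeff_X_pow] at hj ⊢
  omega

/-- The matrix of the symmetric power of a `2 × 2` matrix, in the basis of monomials, is up to
binomial coefficients transposed together with the matrix. -/
theorem choose_mul_coeff_linear_pow_mul (a b c d : ℂ) {n i j : ℕ} (hi : i ≤ n) (hj : j ≤ n) :
    (n.choose j : ℂ) * ((C a * X + C b) ^ j * (C c * X + C d) ^ (n - j)).coeff i =
      n.choose i * ((C a * X + C c) ^ i * (C b * X + C d) ^ (n - i)).coeff j := by
  -- Generating function in `y`: both sides are the coefficient of `X ^ i` in `((a y + c) X + (b y +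
  -- d)) ^ n`, expanded either by powers of `y` or by powers of `X`.
  have key : (∑ k ∈ Finset.range (n + 1),
      C ((n.choose k : ℂ) * ((C a * X + C b) ^ k * (C c * X + C d) ^ (n - k)).coeff i) * X ^ k) =
        C (n.choose i : ℂ) * ((C a * X + C c) ^ i * (C b * X + C d) ^ (n - i)) := by
    refine Polynomial.funext fun y => ?_
    have h1 : (C (a * y + c) * X + C (b * y + d)) ^ n =
        ∑ k ∈ Finset.range (n + 1), C (y ^ k * n.choose k) *
          ((C a * X + C b) ^ k * (C c * X + C d) ^ (n - k)) := by
      have : C (a * y + c) * X + C (b * y + d) = C y * (C a * X + C b) + (C c * X + C d) := by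
        simp only [C_add, C_mul]; ring
      rw [this, add_pow]
      refine Finset.sum_congr rfl fun k _ => ?_
      rw [C_mul, C_pow, C_eq_natCast, mul_pow]; ring
    have h2 := congrArg (fun p => coeff p i) h1
    simp only [coeff_linear_pow _ _ hi, finsetSum_coeff, coeff_C_mul] at h2
    simp only [eval_finsetSum, eval_mul, eval_C, eval_pow, eval_X, eval_add]
    rw [mul_comm (n.choose i : ℂ), h2]
    exact Finset.sum_congr rfl fun k _ => by ring
  have h3 := congrArg (fun p => coeff p j) key
  simp only [coeff_C_mul] at h3
  rw [← h3, coeff_sum_C_mul_X_pow n _ j (Finset.mem_range.2 (by omega))]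

end LinearPowers

/-! ### The Wigner functions as matrix coefficients of a unitary representation -/

section Wigner

open Polynomial

variable {n : ℕ}

theorem sqrt_choose_ne_zero (i : Fin (n + 1)) : (Real.sqrt (n.choose i) : ℂ) ≠ 0 := by
  have : 0 < n.choose i := Nat.choose_pos (by omega)
  exact_mod_cast (Real.sqrt_pos.2 (by exact_mod_cast this)).ne'

theorem sqrt_choose_mul_self (i : Fin (n + 1)) :
    (Real.sqrt (n.choose i) : ℂ) * Real.sqrt (n.choose i) = n.choose i := by
  rw [← Complex.ofReal_mul, Real.mul_self_sqrt (Nat.cast_nonneg _), Complex.ofReal_natCast]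

/-- Substituting the two linear forms of `g` for the variables of column `j` of `h` produces the two
linear forms of `g * h`. The square roots indexed by `k` cancel. -/
theorem wignerD_mul (i j : Fin (n + 1)) (g h : SU2) :
    wignerD n i j (g * h) = ∑ k, wignerD n i k g * wignerD n k j h := by
  have key := sum_coeff_linear_pow_mul (A := ℂ[X]) (conj (h.1 0 0)) (conj (h.1 1 0)) (-(h.1 1 0))
    (h.1 0 0) (n := n) (j := j) (by omega) (C (conj (g.1 0 0)) * X + C (conj (g.1 1 0)))
    (C (-(g.1 1 0)) * X + C (g.1 0 0))
  have e1 : C (conj ((g * h).1 0 0)) * X + C (conj ((g * h).1 1 0)) =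
      algebraMap ℂ ℂ[X] (conj (h.1 0 0)) * (C (conj (g.1 0 0)) * X + C (conj (g.1 1 0))) +
        algebraMap ℂ ℂ[X] (conj (h.1 1 0)) * (C (-(g.1 1 0)) * X + C (g.1 0 0)) := by
    rw [SU2.mul_val_zero_zero, SU2.mul_val_one_zero]
    simp only [map_add, map_sub, map_mul, map_neg, Complex.conj_conj, algebraMap_eq]
    ring
  have e2 : C (-((g * h).1 1 0)) * X + C ((g * h).1 0 0) =
      algebraMap ℂ ℂ[X] (-(h.1 1 0)) * (C (conj (g.1 0 0)) * X + C (conj (g.1 1 0))) +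
        algebraMap ℂ ℂ[X] (h.1 0 0) * (C (-(g.1 1 0)) * X + C (g.1 0 0)) := by
    rw [SU2.mul_val_zero_zero, SU2.mul_val_one_zero]
    simp only [map_add, map_sub, map_mul, map_neg, algebraMap_eq]
    ring
  rw [wignerD, e1, e2, ← key, finsetSum_coeff, Finset.mul_sum]
  refine Finset.sum_congr rfl fun k _ => ?_
  rw [wignerD, wignerD, algebraMap_eq, mul_assoc (C _), coeff_C_mul]
  push_cast
  have := sqrt_choose_ne_zero k
  have := sqrt_choose_ne_zero i
  field_simp

/-- In `SU(2)` the inverse is the conjugate transpose, and symmetric powers respect transposition up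
to the binomials of `choose_mul_coeff_linear_pow_mul`. The square roots in `wignerD` are the
normalization that absorbs them, making the representation unitary. -/
theorem wignerD_inv (i j : Fin (n + 1)) (g : SU2) :
    wignerD n i j g⁻¹ = conj (wignerD n j i g) := by
  have key := choose_mul_coeff_linear_pow_mul (g.1 0 0) (-conj (g.1 1 0)) (g.1 1 0)
    (conj (g.1 0 0)) (n := n) (i := i) (j := j) (by omega) (by omega)
  have e : conj (((C (conj (g.1 0 0)) * X + C (conj (g.1 1 0))) ^ (i : ℕ) *
      (C (-(g.1 1 0)) * X + C (g.1 0 0)) ^ (n - (i : ℕ))).coeff (j : ℕ)) =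
      ((C (g.1 0 0) * X + C (g.1 1 0)) ^ (i : ℕ) *
      (C (-conj (g.1 1 0)) * X + C (conj (g.1 0 0))) ^ (n - (i : ℕ))).coeff (j : ℕ) := by
    rw [← coeff_map]
    simp
  rw [wignerD, wignerD, map_mul, e, Complex.conj_ofReal, SU2.inv_val_zero_zero,
    SU2.inv_val_one_zero, Complex.conj_conj, neg_neg, map_neg]
  have hi := sqrt_choose_ne_zero i
  have hj := sqrt_choose_ne_zero j
  push_cast
  rw [div_mul_eq_mul_div, div_mul_eq_mul_div, div_eq_div_iff hi hj, mul_right_comm,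
    sqrt_choose_mul_self, key, mul_right_comm, sqrt_choose_mul_self]

theorem wignerD_one (i j : Fin (n + 1)) : wignerD n i j 1 = if i = j then 1 else 0 := by
  have hc : ((1 : SU2).1 1 0) = 0 := by simp
  have ha : ((1 : SU2).1 0 0) = 1 := by simp
  rw [wignerD, hc, ha]
  simp only [map_one, map_zero, neg_zero, one_mul, zero_mul, zero_add, add_zero, one_pow, mul_one,
    coeff_X_pow, Fin.val_inj]
  split_ifs with h
  · subst h
    rw [mul_one]
    push_cast
    exact div_self (sqrt_choose_ne_zero i)
  · rw [mul_zero]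

/-- The Wigner functions of degree `n` as a matrix valued function. -/
noncomputable def wignerMatrix (n : ℕ) (g : SU2) : Matrix (Fin (n + 1)) (Fin (n + 1)) ℂ :=
  Matrix.of fun i j => wignerD n i j g

theorem wignerMatrix_mul_conjTranspose (g : SU2) :
    wignerMatrix n g * (wignerMatrix n g).conjTranspose = 1 := by
  ext i j
  rw [Matrix.mul_apply, Matrix.one_apply, ← wignerD_one, ← mul_inv_cancel g, wignerD_mul]
  exact Finset.sum_congr rfl fun k _ => by rw [wignerD_inv]; rfl

theorem wignerMatrix_conjTranspose_mul (g : SU2) :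
    (wignerMatrix n g).conjTranspose * wignerMatrix n g = 1 :=
  mul_eq_one_comm.1 (wignerMatrix_mul_conjTranspose g)

theorem sum_conj_wignerD_mul (i j : Fin (n + 1)) (g : SU2) :
    ∑ k, conj (wignerD n k i g) * wignerD n k j g = if i = j then 1 else 0 := by
  simpa [Matrix.mul_apply, Matrix.one_apply, wignerMatrix] using
    congrFun (congrFun (wignerMatrix_conjTranspose_mul g) i) j

/-- The extreme column comes from the `n`-th power of a single linear form, so its entries are
nonzero multiples of monomials in the coordinates of `h`. This takes the place of irreducibility in
Schur's lemma: one such `h` links the extreme weight to every other. -/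
theorem wignerD_zero_right_ne_zero {h : SU2} (h0 : h.1 0 0 ≠ 0) (h1 : h.1 1 0 ≠ 0)
    (i : Fin (n + 1)) : wignerD n i 0 h ≠ 0 := by
  rw [wignerD]
  refine mul_ne_zero ?_ ?_
  · push_cast
    exact div_ne_zero (sqrt_choose_ne_zero 0) (sqrt_choose_ne_zero i)
  · simp only [Fin.val_zero, pow_zero, one_mul, Nat.sub_zero]
    rw [coeff_linear_pow _ _ (by omega)]
    have : n.choose i ≠ 0 := (Nat.choose_pos (by omega)).ne'
    simp [h0, h1, this]

theorem wignerD_zero_left_ne_zero {h : SU2} (h0 : h.1 0 0 ≠ 0) (h1 : h.1 1 0 ≠ 0)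
    (j : Fin (n + 1)) : wignerD n 0 j h ≠ 0 := by
  have := wignerD_zero_right_ne_zero (h := h⁻¹) (n := n)
    (by rw [SU2.inv_val_zero_zero]; simpa) (by rw [SU2.inv_val_one_zero]; simpa) j
  rw [wignerD_inv] at this
  simpa using this

theorem SU2.g3_val_zero_zero (ψ : ℝ) : (SU2.g3 ψ).1 0 0 = Complex.exp (Complex.I * ψ / 2) := rfl

theorem SU2.g3_val_one_zero (ψ : ℝ) : (SU2.g3 ψ).1 1 0 = 0 := rfl

theorem wignerD_g3 (i j : Fin (n + 1)) (ψ : ℝ) :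
    wignerD n i j (SU2.g3 ψ) =
      if i = j then Complex.exp (Complex.I * ((-spinValue n j : ℚ) : ℂ) * ψ) else 0 := by
  rw [wignerD, SU2.g3_val_zero_zero, SU2.g3_val_one_zero]
  simp only [map_zero, neg_zero, zero_mul, zero_add, add_zero]
  rw [mul_pow, ← C_pow, ← C_pow, mul_right_comm, ← C_mul, coeff_C_mul, coeff_X_pow]
  simp only [Fin.val_inj]
  split_ifs with h
  · subst h
    push_cast
    rw [div_self (sqrt_choose_ne_zero i), one_mul, mul_one, ← Complex.exp_conj, ← Complex.exp_nat_mul,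
      ← Complex.exp_nat_mul, ← Complex.exp_add]
    congr 1
    rw [Nat.cast_sub (by omega), spinValue]
    simp only [map_div₀, map_mul, Complex.conj_I, Complex.conj_ofReal, Complex.conj_ofNat]
    push_cast
    ring
  · simp

theorem wignerD_mul_g3 (i j : Fin (n + 1)) (g : SU2) (ψ : ℝ) :
    wignerD n i j (g * SU2.g3 ψ) =
      wignerD n i j g * Complex.exp (Complex.I * ((-spinValue n j : ℚ) : ℂ) * ψ) := by
  rw [wignerD_mul, Finset.sum_eq_single j]
  · rw [wignerD_g3, if_pos rfl]
  · intro k _ hk; rw [wignerD_g3, if_neg hk, mul_zero]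
  · simp

theorem wignerD_g3_mul (i j : Fin (n + 1)) (g : SU2) (ψ : ℝ) :
    wignerD n i j (SU2.g3 ψ * g) =
      Complex.exp (Complex.I * ((-spinValue n i : ℚ) : ℂ) * ψ) * wignerD n i j g := by
  rw [wignerD_mul, Finset.sum_eq_single i]
  · rw [wignerD_g3, if_pos rfl]
  · intro k _ hk; rw [wignerD_g3, if_neg hk.symm, zero_mul]
  · simp

theorem spinValue_injective (n : ℕ) : Function.Injective (spinValue n) := by
  intro i j h
  simp only [spinValue, sub_left_inj, Nat.cast_inj] at h
  exact Fin.ext h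

/-! ### Smoothness -/

/-- Products of families of polynomials with smooth coefficients have smooth coefficients. -/
theorem contDiff_coeff_mul {E : Type*} [NormedAddCommGroup E] [NormedSpace ℝ E]
    {p q : E → ℂ[X]} {r : WithTop ℕ∞} (hp : ∀ i, ContDiff ℝ r fun x => (p x).coeff i)
    (hq : ∀ i, ContDiff ℝ r fun x => (q x).coeff i) (i : ℕ) :
    ContDiff ℝ r fun x => (p x * q x).coeff i := by
  simp only [coeff_mul]
  exact ContDiff.sum fun k _ => (hp _).mul (hq _)

theorem contDiff_coeff_pow {E : Type*} [NormedAddCommGroup E] [NormedSpace ℝ E]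
    {p : E → ℂ[X]} {r : WithTop ℕ∞} (hp : ∀ i, ContDiff ℝ r fun x => (p x).coeff i) (k i : ℕ) :
    ContDiff ℝ r fun x => (p x ^ k).coeff i := by
  induction k generalizing i with
  | zero => simpa using contDiff_const
  | succ k ih => simpa only [pow_succ] using contDiff_coeff_mul ih hp i

theorem contDiff_coeff_linear {E : Type*} [NormedAddCommGroup E] [NormedSpace ℝ E]
    {u v : E → ℂ} {r : WithTop ℕ∞} (hu : ContDiff ℝ r u) (hv : ContDiff ℝ r v) (i : ℕ) :
    ContDiff ℝ r fun x => (C (u x) * X + C (v x)).coeff i := by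
  simp only [coeff_add, coeff_C_mul, coeff_C]
  refine (hu.mul contDiff_const).add ?_
  split_ifs
  exacts [hv, contDiff_const]

theorem isSmooth_wignerD (i j : Fin (n + 1)) : SU2.IsSmooth (wignerD n i j) := by
  refine ⟨fun x => (Real.sqrt (n.choose j) / Real.sqrt (n.choose i) : ℝ) *
    ((C (conj x.1) * X + C (conj x.2)) ^ (j : ℕ) *
      (C (-x.2) * X + C x.1) ^ (n - (j : ℕ))).coeff (i : ℕ), ?_, fun g => rfl⟩
  have hc : ContDiff ℝ ((⊤ : ℕ∞) : WithTop ℕ∞) (fun z : ℂ => conj z) :=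
    Complex.conjCLE.contDiff
  refine contDiff_const.mul (contDiff_coeff_mul (contDiff_coeff_pow ?_ _)
    (contDiff_coeff_pow ?_ _) _)
  · exact contDiff_coeff_linear (hc.comp contDiff_fst) (hc.comp contDiff_snd)
  · exact contDiff_coeff_linear contDiff_snd.neg contDiff_fst

theorem SU2.IsSmooth.continuous {F : SU2 → ℂ} (hF : SU2.IsSmooth F) : Continuous F := by
  obtain ⟨G, hG, h⟩ := hF
  rw [funext h]
  refine hG.continuous.comp (Continuous.prodMk ?_ ?_)
  · exact (continuous_apply_apply (0 : Fin 2) (0 : Fin 2)).comp continuous_subtype_val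
  · exact (continuous_apply_apply (1 : Fin 2) (0 : Fin 2)).comp continuous_subtype_val

theorem continuous_wignerD (i j : Fin (n + 1)) : Continuous (wignerD n i j) :=
  (isSmooth_wignerD i j).continuous

theorem continuous_wignerPhi (i j : Fin (n + 1)) : Continuous (wignerPhi n i j) :=
  continuous_const.mul (continuous_wignerD i j)

end Wigner

/-! ### Haar measure on `SU(2)` -/

namespace SU2

/-- The normalized Haar measure of `SU(2)`. -/
noncomputable abbrev haar : Measure SU2 := Measure.haarMeasure ⊤

instance : IsProbabilityMeasure haar := ⟨by
  have := Measure.haarMeasure_self (K₀ := (⊤ : TopologicalSpace.PositiveCompacts SU2))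
  rwa [TopologicalSpace.PositiveCompacts.coe_top] at this⟩

/-- Left and right translations commute, so a right translate of Haar measure is a left invariant
probability, and uniqueness applies. -/
instance : haar.IsMulRightInvariant where
  map_mul_right_eq_self b := by
    have : IsProbabilityMeasure (haar.map (· * b)) :=
      Measure.isProbabilityMeasure_map (measurable_mul_const b).aemeasurable
    have : (haar.map (· * b)).IsMulLeftInvariant := by
      refine ⟨fun a => ?_⟩
      rw [Measure.map_map (measurable_const_mul a) (measurable_mul_const b)]
      have : (fun x => a * x) ∘ (fun x => x * b) = (fun x => x * b) ∘ fun x => a * x := by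
        funext x; simp [mul_assoc]
      rw [this, ← Measure.map_map (measurable_mul_const b) (measurable_const_mul a),
        map_mul_left_eq_self]
    have := Measure.haarMeasure_unique (haar.map (· * b)) ⊤
    rwa [TopologicalSpace.PositiveCompacts.coe_top, measure_univ, one_smul] at this

theorem vol_eq : vol = ENNReal.ofReal (16 * Real.pi ^ 2) • haar := rfl

instance : IsFiniteMeasure vol := by
  rw [vol_eq]; exact Measure.smul_finite _ ENNReal.ofReal_ne_top

instance : vol.IsMulLeftInvariant := by rw [vol_eq]; infer_instance

instance : vol.IsMulRightInvariant := by rw [vol_eq]; infer_instance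

theorem integral_vol {E : Type*} [NormedAddCommGroup E] [NormedSpace ℝ E] (f : SU2 → E) :
    ∫ g, f g ∂vol = (16 * Real.pi ^ 2) • ∫ g, f g ∂haar := by
  rw [vol_eq, integral_smul_measure, ENNReal.toReal_ofReal (by positivity)]

theorem integrable_vol_iff {E : Type*} [NormedAddCommGroup E] {f : SU2 → E} :
    Integrable f vol ↔ Integrable f haar := by
  rw [vol_eq]
  exact integrable_smul_measure (by positivity) ENNReal.ofReal_ne_top

theorem _root_.Continuous.integrable_of_su2 {E : Type*} [NormedAddCommGroup E]
    {f : SU2 → E} (hf : Continuous f) (ν : Measure SU2) [IsFiniteMeasure ν] :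
    Integrable f ν := by
  have := TopologicalSpace.metrizableSpace_of_t3_secondCountable SU2
  let := TopologicalSpace.metrizableSpaceMetric SU2
  obtain ⟨C, hC⟩ := isCompact_univ.exists_bound_of_continuousOn hf.continuousOn
  exact Integrable.of_bound hf.aestronglyMeasurable C (.of_forall fun x => hC x trivial)

end SU2

/-! ### Schur orthogonality -/

/-- At `ψ = π / r` the character is `-1`. This serves both Schur orthogonality and the vanishing of
moments of random coefficients. -/
theorem eq_zero_of_eq_exp_mul {r : ℚ} (hr : r ≠ 0) {z : ℂ}
    (h : ∀ ψ : ℝ, z = Complex.exp (Complex.I * (r : ℂ) * ψ) * z) : z = 0 := by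
  have h1 := h (Real.pi / r)
  have hr' : (r : ℂ) ≠ 0 := by exact_mod_cast hr
  have : Complex.I * (r : ℂ) * ((Real.pi / r : ℝ) : ℂ) = Real.pi * Complex.I := by
    push_cast; field_simp
  rw [this, Complex.exp_pi_mul_I] at h1
  have h2 : (2 : ℂ) * z = 0 := by linear_combination h1
  simpa using h2

section Orthogonality

variable {n n' : ℕ}

theorem conj_exp_spin (r : ℚ) (ψ : ℝ) :
    conj (Complex.exp (Complex.I * (r : ℂ) * ψ)) =
      Complex.exp (Complex.I * ((-r : ℚ) : ℂ) * ψ) := by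
  rw [← Complex.exp_conj]
  simp

theorem exp_spin_mul (r t : ℚ) (ψ : ℝ) :
    Complex.exp (Complex.I * (r : ℂ) * ψ) * Complex.exp (Complex.I * (t : ℂ) * ψ) =
      Complex.exp (Complex.I * ((r + t : ℚ) : ℂ) * ψ) := by
  rw [← Complex.exp_add]; congr 1; push_cast; ring

/-- The inner products of Wigner functions. -/
noncomputable def wignerInner (n n' : ℕ) (i j : Fin (n + 1)) (k l : Fin (n' + 1)) : ℂ :=
  ∫ g, wignerD n i j g * conj (wignerD n' k l g) ∂SU2.haar

theorem continuous_wignerD_mul_conj (i j : Fin (n + 1)) (k l : Fin (n' + 1)) :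
    Continuous fun g => wignerD n i j g * conj (wignerD n' k l g) :=
  (continuous_wignerD i j).mul (Complex.continuous_conj.comp (continuous_wignerD k l))

theorem integrable_wignerD_mul_conj (i j : Fin (n + 1)) (k l : Fin (n' + 1)) :
    Integrable (fun g => wignerD n i j g * conj (wignerD n' k l g)) SU2.haar :=
  (continuous_wignerD_mul_conj i j k l).integrable_of_su2 _

/-- Translating the variable by `g₃(ψ)` multiplies the integral by a character whose weight is the
difference of the spins. -/
theorem wignerInner_eq_zero_of_right {i j : Fin (n + 1)} {k l : Fin (n' + 1)}
    (h : spinValue n j ≠ spinValue n' l) : wignerInner n n' i j k l = 0 := by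
  refine eq_zero_of_eq_exp_mul (r := -spinValue n j + spinValue n' l)
    (fun h0 => h (by linarith)) fun ψ => ?_
  rw [wignerInner, ← integral_const_mul, ← integral_mul_right_eq_self _ (SU2.g3 ψ)]
  congr 1; funext g
  rw [wignerD_mul_g3, wignerD_mul_g3, map_mul, conj_exp_spin, ← exp_spin_mul, neg_neg]
  ring

theorem wignerInner_eq_zero_of_left {i j : Fin (n + 1)} {k l : Fin (n' + 1)}
    (h : spinValue n i ≠ spinValue n' k) : wignerInner n n' i j k l = 0 := by
  refine eq_zero_of_eq_exp_mul (r := -spinValue n i + spinValue n' k)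
    (fun h0 => h (by linarith)) fun ψ => ?_
  rw [wignerInner, ← integral_const_mul, ← integral_mul_left_eq_self _ (SU2.g3 ψ)]
  congr 1; funext g
  rw [wignerD_g3_mul, wignerD_g3_mul, map_mul, conj_exp_spin, ← exp_spin_mul, neg_neg]
  ring

/-- The matrix of inner products intertwines the two representations. -/
theorem wignerInner_intertwines (h : SU2) (i j : Fin (n + 1)) (q l : Fin (n' + 1)) :
    ∑ p, wignerD n i p h * wignerInner n n' p j q l =
      ∑ k, wignerInner n n' i j k l * wignerD n' k q h := by
  have e1 : ∑ p, wignerD n i p h * wignerInner n n' p j q l =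
      ∫ g, wignerD n i j (h * g) * conj (wignerD n' q l g) ∂SU2.haar := by
    simp only [wignerD_mul, Finset.sum_mul, mul_assoc]
    rw [integral_finsetSum _ fun p _ => (integrable_wignerD_mul_conj p j q l).const_mul _]
    exact Finset.sum_congr rfl fun p _ => (integral_const_mul _ _).symm
  have e2 : ∑ k, wignerInner n n' i j k l * wignerD n' k q h =
      ∫ g, wignerD n i j g * conj (wignerD n' q l (h⁻¹ * g)) ∂SU2.haar := by
    simp only [wignerD_mul, map_sum, map_mul, wignerD_inv, Complex.conj_conj, Finset.mul_sum]
    have : ∀ g k, wignerD n i j g * (wignerD n' k q h * conj (wignerD n' k l g)) =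
        (wignerD n i j g * conj (wignerD n' k l g)) * wignerD n' k q h := fun g k => by ring
    simp only [this]
    rw [integral_finsetSum _ fun k _ => (integrable_wignerD_mul_conj i j k l).mul_const _]
    exact Finset.sum_congr rfl fun k _ => (integral_mul_const _ _).symm
  rw [e1, e2, ← integral_mul_left_eq_self
    (fun g => wignerD n i j g * conj (wignerD n' q l (h⁻¹ * g))) h]
  simp only [inv_mul_cancel_left]

/-- The weight `-n/2` does not occur in degree `n' < n`, so row `0` vanishes. In the intertwining
relation for row `0`, weights leave only the term with index `i`, and its factor `D₀ᵢ(h)` is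
nonzero. -/
theorem wignerInner_eq_zero_of_lt (hn : n' < n) (i j : Fin (n + 1)) (k l : Fin (n' + 1)) :
    wignerInner n n' i j k l = 0 := by
  by_cases hik : spinValue n i = spinValue n' k
  · obtain ⟨h, h0, h1⟩ := SU2.exists_val_ne_zero
    have key := wignerInner_intertwines h 0 j k l
    have hr : ∀ q : Fin (n' + 1), wignerInner n n' 0 j q l = 0 := fun q => by
      refine wignerInner_eq_zero_of_left ?_
      simp only [spinValue, Fin.val_zero, Nat.cast_zero]
      have : (n' : ℚ) < n := by exact_mod_cast hn
      have : (0 : ℚ) ≤ (q : ℕ) := Nat.cast_nonneg _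
      intro h; linarith
    rw [Finset.sum_eq_single i] at key
    · simp only [hr, zero_mul, Finset.sum_const_zero] at key
      exact (mul_eq_zero.1 key).resolve_left (wignerD_zero_left_ne_zero h0 h1 i)
    · intro p _ hp
      rw [wignerInner_eq_zero_of_left, mul_zero]
      rw [← hik]
      exact fun h => hp (spinValue_injective n h)
    · simp
  · exact wignerInner_eq_zero_of_left hik

theorem conj_wignerInner (i j : Fin (n + 1)) (k l : Fin (n' + 1)) :
    conj (wignerInner n n' i j k l) = wignerInner n' n k l i j := by
  rw [wignerInner, ← integral_conj]
  simp only [map_mul, Complex.conj_conj, mul_comm]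
  rfl

theorem wignerInner_eq_zero_of_ne (hn : n ≠ n') (i j : Fin (n + 1)) (k l : Fin (n' + 1)) :
    wignerInner n n' i j k l = 0 := by
  rcases hn.lt_or_gt with h | h
  · rw [← conj_wignerInner, wignerInner_eq_zero_of_lt h, map_zero]
  · exact wignerInner_eq_zero_of_lt h i j k l

/-- For fixed `j`, the intertwiner is diagonal in the row indices; comparing its `(0, i)` entries
and cancelling `D₀ᵢ(h) ≠ 0` shows that it is scalar. -/
theorem wignerInner_self_eq (i j : Fin (n + 1)) :
    wignerInner n n i j i j = wignerInner n n 0 j 0 j := by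
  obtain ⟨h, h0, h1⟩ := SU2.exists_val_ne_zero
  have key := wignerInner_intertwines (n' := n) h 0 j i j
  have hz : ∀ p q : Fin (n + 1), p ≠ q → wignerInner n n p j q j = 0 := fun p q hpq =>
    wignerInner_eq_zero_of_left fun h => hpq (spinValue_injective n h)
  rw [Finset.sum_eq_single i (fun p _ hp => by rw [hz p i hp, mul_zero]) (by simp),
    Finset.sum_eq_single 0 (fun k _ hk => by rw [hz 0 k hk.symm, zero_mul]) (by simp),
    mul_comm] at key
  exact mul_right_cancel₀ (wignerD_zero_left_ne_zero h0 h1 i) key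

/-- The columns of a unitary matrix have norm one, so the `n + 1` equal inner products add up to
`1`. -/
theorem wignerInner_self (i j : Fin (n + 1)) : wignerInner n n i j i j = ((n : ℂ) + 1)⁻¹ := by
  have h : ∑ k, wignerInner n n k j k j = 1 := by
    simp only [wignerInner]
    rw [← integral_finsetSum _ fun k _ => integrable_wignerD_mul_conj k j k j]
    have : ∀ g, ∑ k, wignerD n k j g * conj (wignerD n k j g) = 1 := fun g => by
      rw [← (sum_conj_wignerD_mul j j g).trans (if_pos rfl)]
      exact Finset.sum_congr rfl fun k _ => mul_comm _ _
    simp [this]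
  simp only [wignerInner_self_eq, Finset.sum_const, Finset.card_univ, Fintype.card_fin,
    nsmul_eq_mul] at h
  rw [wignerInner_self_eq]
  push_cast at h
  exact eq_inv_of_mul_eq_one_right h

theorem wignerInner_eq_ite (i j k l : Fin (n + 1)) :
    wignerInner n n i j k l = if i = k ∧ j = l then ((n : ℂ) + 1)⁻¹ else 0 := by
  split_ifs with h
  · rw [h.1, h.2, wignerInner_self]
  · rw [not_and_or] at h
    rcases h with h | h
    · exact wignerInner_eq_zero_of_left fun h' => h (spinValue_injective n h')
    · exact wignerInner_eq_zero_of_right fun h' => h (spinValue_injective n h')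

theorem integral_wignerPhi_mul_conj (i j : Fin (n + 1)) (k l : Fin (n' + 1)) :
    ∫ g, wignerPhi n i j g * conj (wignerPhi n' k l g) ∂SU2.vol =
      Real.sqrt (n + 1) * Real.sqrt (n' + 1) * wignerInner n n' i j k l := by
  have : ∀ g, wignerPhi n i j g * conj (wignerPhi n' k l g) =
      ((Real.sqrt (n + 1) / (4 * Real.pi) : ℝ) * (Real.sqrt (n' + 1) / (4 * Real.pi) : ℝ) : ℂ) *
        (wignerD n i j g * conj (wignerD n' k l g)) := fun g => by
    rw [wignerPhi, wignerPhi, map_mul, Complex.conj_ofReal]; ring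
  simp only [this]
  rw [SU2.integral_vol, integral_const_mul, wignerInner, Complex.real_smul]
  have hpi : (Real.pi : ℂ) ≠ 0 := by exact_mod_cast Real.pi_ne_zero
  push_cast
  field_simp
  ring

theorem integral_wignerPhi_mul_conj_eq_ite (p q : Fin (n + 1) × Fin (n + 1)) :
    ∫ g, wignerPhi n p.1 p.2 g * conj (wignerPhi n q.1 q.2 g) ∂SU2.vol =
      if p = q then ((1 : ℝ) : ℂ) else 0 := by
  rw [integral_wignerPhi_mul_conj, wignerInner_eq_ite, ← Complex.ofReal_mul,
    Real.mul_self_sqrt (by positivity)]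
  simp only [Prod.ext_iff]
  split_ifs
  · push_cast
    exact mul_inv_cancel₀ (by exact_mod_cast n.succ_ne_zero)
  · rw [mul_zero]

/-! ### Parseval's identity for finite sums -/

/-- The constant `κ` is `1` for the harmonics with the volume measure, and `(n+1)⁻¹` for one row of
Wigner functions with the Haar probability. -/
theorem lintegral_enorm_sum_sq {ι : Type*} [Fintype ι] [DecidableEq ι] {e : ι → SU2 → ℂ}
    {ν : Measure SU2} [IsFiniteMeasure ν] {κ : ℝ} (he : ∀ p, Continuous (e p))
    (ho : ∀ p q, ∫ g, e p g * conj (e q g) ∂ν = if p = q then (κ : ℂ) else 0) (hκ : 0 ≤ κ)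
    (c : ι → ℂ) :
    ∫⁻ g, ‖∑ p, c p * e p g‖ₑ ^ 2 ∂ν = ENNReal.ofReal κ * ∑ p, ‖c p‖ₑ ^ 2 := by
  have hcont : Continuous fun g => ∑ p, c p * e p g :=
    continuous_finsetSum _ fun p _ => continuous_const.mul (he p)
  have h1 : ∫ g, ((‖∑ p, c p * e p g‖ ^ 2 : ℝ) : ℂ) ∂ν = ((κ * ∑ p, ‖c p‖ ^ 2 : ℝ) : ℂ) := by
    have : ∀ g, ((‖∑ p, c p * e p g‖ ^ 2 : ℝ) : ℂ) =
        ∑ p, ∑ q, (c p * conj (c q)) * (e p g * conj (e q g)) := fun g => by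
      rw [Complex.ofReal_pow, ← Complex.mul_conj', map_sum, Finset.sum_mul_sum]
      exact Finset.sum_congr rfl fun p _ => Finset.sum_congr rfl fun q _ => by
        rw [map_mul]; ring
    simp only [this]
    have hi : ∀ p q, Integrable (fun g => (c p * conj (c q)) * (e p g * conj (e q g))) ν :=
      fun p q => (((he p).mul (Complex.continuous_conj.comp (he q))).integrable_of_su2 ν).const_mul _
    rw [integral_finsetSum _ fun p _ => integrable_finsetSum _ fun q _ => hi p q]
    simp only [integral_finsetSum _ fun q _ => hi _ q, integral_const_mul, ho]
    push_cast
    rw [Finset.mul_sum]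
    refine Finset.sum_congr rfl fun p _ => ?_
    simp only [mul_ite, mul_zero, Finset.sum_ite_eq, Finset.mem_univ, if_true]
    rw [Complex.mul_conj', mul_comm]
  rw [integral_complex_ofReal] at h1
  have h2 := congrArg ENNReal.ofReal (Complex.ofReal_injective h1)
  rw [ofReal_integral_eq_lintegral_ofReal ((by fun_prop : Continuous fun g => ‖∑ p, c p * e p g‖ ^ 2).integrable_of_su2 ν)
    (.of_forall fun g => by positivity), ENNReal.ofReal_mul hκ,
    ENNReal.ofReal_sum_of_nonneg fun _ _ => by positivity] at h2
  simpa only [ENNReal.ofReal_pow (norm_nonneg _), ofReal_norm] using h2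

theorem lintegral_enorm_sum_wignerD_sq (j : Fin (n + 1)) (c : Fin (n + 1) → ℂ) :
    ∫⁻ g, ‖∑ l, c l * wignerD n j l g‖ₑ ^ 2 ∂SU2.haar =
      ((n : ℝ≥0∞) + 1)⁻¹ * ∑ l, ‖c l‖ₑ ^ 2 := by
  rw [lintegral_enorm_sum_sq (κ := ((n : ℝ) + 1)⁻¹) (fun l => continuous_wignerD j l) ?_
    (by positivity)]
  · rw [ENNReal.ofReal_inv_of_pos (by positivity), ENNReal.ofReal_add (by positivity) zero_le_one]
    simp
  · intro p q
    have := wignerInner_eq_ite j p j q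
    rw [wignerInner] at this
    rw [this]
    simp

/-- Unitarity at a fixed group element; `lintegral_enorm_sum_wignerD_sq` is its counterpart for a
single row, averaged over the group. -/
theorem sum_enorm_sum_wignerD_sq (b : SU2) (c : Fin (n + 1) → ℂ) :
    ∑ j, ‖∑ l, c l * wignerD n j l b‖ₑ ^ 2 = ∑ l, ‖c l‖ₑ ^ 2 := by
  have h : ((∑ j, ‖∑ l, c l * wignerD n j l b‖ ^ 2 : ℝ) : ℂ) = ((∑ l, ‖c l‖ ^ 2 : ℝ) : ℂ) := by
    push_cast
    have : ∀ j, (‖∑ l, c l * wignerD n j l b‖ : ℂ) ^ 2 =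
        ∑ p, ∑ q, (c p * conj (c q)) * (conj (wignerD n j q b) * wignerD n j p b) := fun j => by
      rw [← Complex.mul_conj', map_sum, Finset.sum_mul_sum]
      exact Finset.sum_congr rfl fun p _ => Finset.sum_congr rfl fun q _ => by
        rw [map_mul]; ring
    simp only [this]
    rw [Finset.sum_comm]
    refine Finset.sum_congr rfl fun p _ => ?_
    rw [Finset.sum_comm]
    simp only [← Finset.mul_sum, sum_conj_wignerD_mul, mul_ite, mul_one, mul_zero,
      Finset.sum_ite_eq', Finset.mem_univ, if_true, Complex.mul_conj']
  have h2 := congrArg ENNReal.ofReal (Complex.ofReal_injective h)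
  rw [ENNReal.ofReal_sum_of_nonneg fun _ _ => by positivity,
    ENNReal.ofReal_sum_of_nonneg fun _ _ => by positivity] at h2
  simpa only [ENNReal.ofReal_pow (norm_nonneg _), ofReal_norm] using h2

/-! ### Action of rotations on Fourier coefficients -/

/-- The action of `SU(2) × SU(2)` on arrays of Fourier coefficients of degree `n`. -/
noncomputable def rotate (a b : SU2) (A : Fin (n + 1) → Fin (n + 1) → ℂ) (i j : Fin (n + 1)) : ℂ :=
  ∑ l, (∑ k, A k l * conj (wignerD n i k a)) * wignerD n j l b

theorem enorm_sum_conj (c d : Fin (n + 1) → ℂ) :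
    ‖∑ k, c k * conj (d k)‖ₑ = ‖∑ k, conj (c k) * d k‖ₑ := by
  rw [← RCLike.enorm_conj (∑ k, conj (c k) * d k)]
  simp

theorem sum_enorm_rotate_sq (a b : SU2) (A : Fin (n + 1) → Fin (n + 1) → ℂ) :
    ∑ i, ∑ j, ‖rotate a b A i j‖ₑ ^ 2 = ∑ i, ∑ j, ‖A i j‖ₑ ^ 2 := by
  simp only [rotate, sum_enorm_sum_wignerD_sq]
  rw [Finset.sum_comm]
  simp only [enorm_sum_conj, sum_enorm_sum_wignerD_sq, RCLike.enorm_conj]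
  exact Finset.sum_comm

theorem continuous_rotate_left (A : Fin (n + 1) → Fin (n + 1) → ℂ) (i j : Fin (n + 1)) :
    Continuous fun p : SU2 × SU2 => rotate p.1 p.2 A i j := by
  refine continuous_finsetSum _ fun l _ => (continuous_finsetSum _ fun k _ =>
    continuous_const.mul ?_).mul ((continuous_wignerD j l).comp continuous_snd)
  exact Complex.continuous_conj.comp ((continuous_wignerD i k).comp continuous_fst)

/-- The mean square of the entries of an array along the orbit of the array. -/
theorem lintegral_enorm_rotate_sq (A : Fin (n + 1) → Fin (n + 1) → ℂ) (i j : Fin (n + 1)) :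
    ∫⁻ a, ∫⁻ b, ‖rotate a b A i j‖ₑ ^ 2 ∂SU2.haar ∂SU2.haar =
      (((n : ℝ≥0∞) + 1)⁻¹) ^ 2 * ∑ k, ∑ l, ‖A k l‖ₑ ^ 2 := by
  -- Integrating over `b` decouples the index `l`, and integrating over `a` then decouples `k`; each
  -- integral contributes one factor `(n+1)⁻¹`.
  simp only [rotate, lintegral_enorm_sum_wignerD_sq]
  have hm : ∀ l, Measurable fun a => ‖∑ k, A k l * conj (wignerD n i k a)‖ₑ ^ 2 := fun l =>
    (Continuous.measurable (continuous_finsetSum _ fun k _ => continuous_const.mul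
      (Complex.continuous_conj.comp (continuous_wignerD i k)))).enorm.pow_const 2
  rw [lintegral_const_mul _ (Finset.measurable_sum _ fun l _ => hm l),
    lintegral_finsetSum _ fun l _ => hm l]
  simp only [enorm_sum_conj, lintegral_enorm_sum_wignerD_sq, RCLike.enorm_conj]
  rw [← Finset.mul_sum, ← mul_assoc, ← sq, Finset.sum_comm]

theorem integrable_mul_conj_wignerPhi {F : SU2 → ℂ} (hF : Integrable F SU2.vol)
    (i j : Fin (n + 1)) : Integrable (fun g => F g * conj (wignerPhi n i j g)) SU2.vol := by
  obtain ⟨C, hC⟩ := isCompact_univ.exists_bound_of_continuousOn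
    (continuous_wignerPhi i j).continuousOn
  exact hF.mul_bdd (c := C)
    (Complex.continuous_conj.comp (continuous_wignerPhi i j)).measurable.aestronglyMeasurable
    (.of_forall fun g => by simpa using hC g trivial)

theorem wignerPhi_mul_mul (a g b : SU2) (i j : Fin (n + 1)) :
    wignerPhi n i j (a * g * b⁻¹) =
      ∑ l, ∑ k, wignerPhi n k l g * wignerD n i k a * conj (wignerD n j l b) := by
  simp only [wignerPhi, wignerD_mul, wignerD_inv, Finset.mul_sum, Finset.sum_mul]
  exact Finset.sum_congr rfl fun l _ => Finset.sum_congr rfl fun k _ => by ring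

/-- The change of variables `g ↦ a g b⁻¹` moves the translation onto the harmonic, where the
representation property expands it. -/
theorem fourierCoef_translate {F : SU2 → ℂ} (hF : Integrable F SU2.vol) (a b : SU2)
    (i j : Fin (n + 1)) :
    fourierCoef (fun g => F (a⁻¹ * g * b)) n i j = rotate a b (fourierCoef F n) i j := by
  rw [fourierCoef, ← integral_mul_left_eq_self _ a, ← integral_mul_right_eq_self _ b⁻¹]
  have : ∀ g : SU2, F (a⁻¹ * (a * (g * b⁻¹)) * b) * conj (wignerPhi n i j (a * (g * b⁻¹))) =
      ∑ l, ∑ k, (F g * conj (wignerPhi n k l g)) * (conj (wignerD n i k a) * wignerD n j l b) := by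
    intro g
    rw [inv_mul_cancel_left, inv_mul_cancel_right, ← mul_assoc a, wignerPhi_mul_mul]
    simp only [map_sum, map_mul, Complex.conj_conj, Finset.mul_sum]
    exact Finset.sum_congr rfl fun l _ => Finset.sum_congr rfl fun k _ => by ring
  simp only [this]
  have hi := fun k l => (integrable_mul_conj_wignerPhi hF k l (n := n)).mul_const
    (conj (wignerD n i k a) * wignerD n j l b)
  rw [integral_finsetSum _ fun l _ => integrable_finsetSum _ fun k _ => hi k l, rotate]
  refine Finset.sum_congr rfl fun l _ => ?_
  rw [integral_finsetSum _ fun k _ => hi k l, Finset.sum_mul]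
  refine Finset.sum_congr rfl fun k _ => ?_
  rw [integral_mul_const, mul_assoc]
  rfl

theorem l2NormSq_translate (F : SU2 → ℂ) (a b : SU2) :
    l2NormSq (fun g => F (a⁻¹ * g * b)) = l2NormSq F := by
  simp only [l2NormSq, mul_assoc]
  rw [lintegral_mul_right_eq_self (fun g => ‖F (a⁻¹ * g)‖ₑ ^ 2) b]
  exact lintegral_mul_left_eq_self (fun g => ‖F g‖ₑ ^ 2) a⁻¹

/-! ### Functions of a fixed degree -/

theorem fourierCoef_sum_self (c : Fin (n + 1) → Fin (n + 1) → ℂ) (k l : Fin (n + 1)) :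
    fourierCoef (fun g => ∑ i, ∑ j, c i j * wignerPhi n i j g) n k l = c k l := by
  simp only [fourierCoef, Finset.sum_mul, mul_assoc]
  have hi : ∀ i j, Integrable
      (fun g => c i j * (wignerPhi n i j g * conj (wignerPhi n k l g))) SU2.vol := fun i j =>
    (((continuous_wignerPhi i j).mul (Complex.continuous_conj.comp
      (continuous_wignerPhi k l))).integrable_of_su2 _).const_mul _
  rw [integral_finsetSum _ fun i _ => integrable_finsetSum _ fun j _ => hi i j]
  simp only [integral_finsetSum _ fun j _ => hi _ j, integral_const_mul]
  have := fun i j => integral_wignerPhi_mul_conj_eq_ite (n := n) (i, j) (k, l)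
  simp only at this
  simp only [this, ← Fintype.sum_prod_type', Prod.mk.eta]
  simp

theorem fourierCoef_sum_of_ne (hn : n ≠ n') (c : Fin (n + 1) → Fin (n + 1) → ℂ)
    (k l : Fin (n' + 1)) :
    fourierCoef (fun g => ∑ i, ∑ j, c i j * wignerPhi n i j g) n' k l = 0 := by
  simp only [fourierCoef, Finset.sum_mul, mul_assoc]
  have hi : ∀ i j, Integrable
      (fun g => c i j * (wignerPhi n i j g * conj (wignerPhi n' k l g))) SU2.vol := fun i j =>
    (((continuous_wignerPhi i j).mul (Complex.continuous_conj.comp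
      (continuous_wignerPhi k l))).integrable_of_su2 _).const_mul _
  rw [integral_finsetSum _ fun i _ => integrable_finsetSum _ fun j _ => hi i j]
  simp only [integral_finsetSum _ fun j _ => hi _ j, integral_const_mul,
    integral_wignerPhi_mul_conj, wignerInner_eq_zero_of_ne hn, mul_zero, Finset.sum_const_zero]

theorem l2NormSq_sum (c : Fin (n + 1) → Fin (n + 1) → ℂ) :
    l2NormSq (fun g => ∑ i, ∑ j, c i j * wignerPhi n i j g) = ∑ i, ∑ j, ‖c i j‖ₑ ^ 2 := by
  have := lintegral_enorm_sum_sq (e := fun p : Fin (n + 1) × Fin (n + 1) => wignerPhi n p.1 p.2)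
    (fun p => continuous_wignerPhi p.1 p.2) integral_wignerPhi_mul_conj_eq_ite zero_le_one
    (fun p => c p.1 p.2)
  simp only [Fintype.sum_prod_type, ENNReal.ofReal_one, one_mul] at this
  exact this

theorem exists_eq_sum_of_mem_wignerSpace {F : SU2 → ℂ} (hF : F ∈ wignerSpace n) :
    ∃ c : Fin (n + 1) → Fin (n + 1) → ℂ, F = fun g => ∑ i, ∑ j, c i j * wignerPhi n i j g := by
  rw [wignerSpace, Submodule.mem_span_range_iff_exists_fun] at hF
  obtain ⟨c, rfl⟩ := hF
  have hs : ((Real.sqrt (n + 1) / (4 * Real.pi) : ℝ) : ℂ) ≠ 0 := by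
    have : 0 < Real.sqrt (n + 1) / (4 * Real.pi) := by positivity
    exact_mod_cast this.ne'
  refine ⟨fun i j => c (i, j) / (Real.sqrt (n + 1) / (4 * Real.pi) : ℝ), ?_⟩
  funext g
  rw [Finset.sum_apply, Fintype.sum_prod_type]
  refine Finset.sum_congr rfl fun i _ => Finset.sum_congr rfl fun j _ => ?_
  rw [wignerPhi, Pi.smul_apply, smul_eq_mul, ← mul_assoc, div_mul_cancel₀ _ hs]

theorem eq_sum_fourierCoef_of_mem_wignerSpace {F : SU2 → ℂ} (hF : F ∈ wignerSpace n) :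
    F = fun g => ∑ i, ∑ j, fourierCoef F n i j * wignerPhi n i j g := by
  obtain ⟨c, rfl⟩ := exists_eq_sum_of_mem_wignerSpace hF
  simp only [fourierCoef_sum_self]

end Orthogonality

/-! ### Laws of integrals of jointly measurable random fields -/

section Sampling

open Filter Topology

variable {Ω S E : Type*} [MeasurableSpace Ω] [MeasurableSpace S] {P : Measure Ω}
  {Q : Measure S} [IsProbabilityMeasure Q]
  [NormedAddCommGroup E] [NormedSpace ℝ E] [CompleteSpace E] [SecondCountableTopology E]
  [MeasurableSpace E] [BorelSpace E]

/-- The integral of an integrable function is the limit of its means along almost every sample. -/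
theorem ae_tendsto_sample_mean {f : S → E} (hf : Measurable f) (hi : Integrable f Q) :
    ∀ᵐ g ∂(Measure.infinitePi fun _ : ℕ => Q),
      Tendsto (fun N : ℕ => (N : ℝ)⁻¹ • ∑ k ∈ Finset.range N, f (g k)) atTop
        (𝓝 (∫ s, f s ∂Q)) := by
  have hmp := measurePreserving_eval_infinitePi (fun _ : ℕ => Q)
  have hint : ∫ g, f (g 0) ∂(Measure.infinitePi fun _ : ℕ => Q) = ∫ s, f s ∂Q := by
    have h := integral_map (μ := Measure.infinitePi fun _ : ℕ => Q) (f := f)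
      (hmp 0).measurable.aemeasurable hf.aestronglyMeasurable
    rw [(hmp 0).map_eq] at h
    exact h.symm
  rw [← hint]
  refine strong_law_ae (fun (k : ℕ) (g : ℕ → S) => f (g k)) ?_ ?_ ?_
  · exact (hmp 0).integrable_comp_of_integrable hi
  · exact fun i j hij => (iIndepFun_infinitePi (P := fun _ : ℕ => Q) (X := fun _ => f)
      fun _ => hf).indepFun hij
  · intro k
    refine ⟨(hf.comp (hmp k).measurable).aemeasurable, (hf.comp (hmp 0).measurable).aemeasurable, ?_⟩
    have h1 := Measure.map_map (μ := Measure.infinitePi fun _ : ℕ => Q) hf (hmp k).measurable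
    have h2 := Measure.map_map (μ := Measure.infinitePi fun _ : ℕ => Q) hf (hmp 0).measurable
    rw [(hmp k).map_eq] at h1
    rw [(hmp 0).map_eq] at h2
    exact h1.symm.trans h2

/-- The strong law holds for each integrable path; Fubini exchanges the quantifiers, so that a
sample sequence can be fixed before `ω`. -/
theorem ae_ae_tendsto_sample_mean [SFinite P] {f : Ω → S → E}
    (hf : Measurable (Function.uncurry f)) (hi : ∀ᵐ ω ∂P, Integrable (f ω) Q) :
    ∀ᵐ g ∂(Measure.infinitePi fun _ : ℕ => Q), ∀ᵐ ω ∂P,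
      Tendsto (fun N : ℕ => (N : ℝ)⁻¹ • ∑ k ∈ Finset.range N, f ω (g k)) atTop
        (𝓝 (∫ s, f ω s ∂Q)) := by
  rw [← Measure.ae_ae_comm]
  · filter_upwards [hi] with ω hω
    exact ae_tendsto_sample_mean (hf.comp measurable_prodMk_left) hω
  · refine measurableSet_tendsto_fun (fun N => ?_) ?_
    · refine Measurable.const_smul (Finset.measurable_sum _ fun k _ => ?_) _
      exact hf.comp (measurable_fst.prodMk ((measurable_pi_apply k).comp measurable_snd))
    · exact (hf.stronglyMeasurable.integral_prod_right (ν := Q)).measurable.comp measurable_fst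

/-- Jointly measurable fields with the same finite-dimensional distributions have integrals with
the same law. -/
theorem identDistrib_integral [SFinite P] {X Y : Ω → S → ℂ} (hX : Measurable (Function.uncurry X))
    (hY : Measurable (Function.uncurry Y)) (h : IdentDistrib X Y P P) {φ : S → ℂ → E}
    (hφ : Measurable (Function.uncurry φ)) (hiX : ∀ᵐ ω ∂P, Integrable (fun s => φ s (X ω s)) Q)
    (hiY : ∀ᵐ ω ∂P, Integrable (fun s => φ s (Y ω s)) Q) :
    IdentDistrib (fun ω => ∫ s, φ s (X ω s) ∂Q) (fun ω => ∫ s, φ s (Y ω s) ∂Q) P P := by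
  have hm : ∀ {Z : Ω → S → ℂ}, Measurable (Function.uncurry Z) →
      Measurable (Function.uncurry fun ω s => φ s (Z ω s)) := fun hZ =>
    hφ.comp (measurable_snd.prodMk hZ)
  -- One sequence that works for both fields, so that the same functional `Φ` represents both
  -- integrals. The value of `limUnder` where the means diverge is irrelevant, this being a null
  -- event.
  obtain ⟨g, hgX, hgY⟩ := ((ae_ae_tendsto_sample_mean (hm hX) hiX).and
    (ae_ae_tendsto_sample_mean (hm hY) hiY)).exists
  let Φ : (S → ℂ) → E := fun x =>
    limUnder atTop fun N : ℕ => (N : ℝ)⁻¹ • ∑ k ∈ Finset.range N, φ (g k) (x (g k))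
  have hΦ : Measurable Φ := by
    refine (StronglyMeasurable.limUnder fun N => Measurable.stronglyMeasurable ?_).measurable
    refine Measurable.const_smul (Finset.measurable_sum _ fun k _ => ?_) _
    exact hφ.comp (measurable_const.prodMk (measurable_pi_apply (g k)))
  have hc := h.comp hΦ
  have aX : Φ ∘ X =ᵐ[P] fun ω => ∫ s, φ s (X ω s) ∂Q := by
    filter_upwards [hgX] with ω hω using hω.limUnder_eq
  have aY : Φ ∘ Y =ᵐ[P] fun ω => ∫ s, φ s (Y ω s) ∂Q := by
    filter_upwards [hgY] with ω hω using hω.limUnder_eq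
  exact (IdentDistrib.of_ae_eq hc.aemeasurable_fst aX).symm.trans
    (hc.trans (IdentDistrib.of_ae_eq hc.aemeasurable_snd aY))

end Sampling

/-! ### Fourier coefficients of random fields and the law of their arrays -/

section Fields

variable {Ω : Type*} [MeasurableSpace Ω] {P : Measure Ω} {X : Ω → SU2 → ℂ} {n : ℕ}

theorem measurable_fourierCoef (hX : Measurable (Function.uncurry X)) (i j : Fin (n + 1)) :
    Measurable fun ω => fourierCoef (X ω) n i j := by
  have : Measurable (Function.uncurry fun ω g => X ω g * conj (wignerPhi n i j g)) :=
    hX.mul ((Complex.continuous_conj.comp (continuous_wignerPhi i j)).measurable.comp measurable_snd)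
  exact (this.stronglyMeasurable.integral_prod_right (ν := SU2.vol)).measurable

theorem measurable_l2NormSq (hX : Measurable (Function.uncurry X)) :
    Measurable fun ω => l2NormSq (X ω) :=
  (hX.enorm.pow_const 2).lintegral_prod_right'

theorem measurable_translate (hX : Measurable (Function.uncurry X)) (a b : SU2) :
    Measurable (Function.uncurry fun ω g => X ω (a * g * b)) :=
  hX.comp (measurable_fst.prodMk ((measurable_snd.const_mul a).mul_const b))

theorem memLp_translate {F : SU2 → ℂ} (hF : MemLp F 2 SU2.vol) (a b : SU2) :
    MemLp (fun g => F (a * g * b)) 2 SU2.vol :=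
  hF.comp_measurePreserving
    ((measurePreserving_mul_right SU2.vol b).comp (measurePreserving_mul_left SU2.vol a))

/-- The value at `g` of the integrands of the Fourier coefficients and of the squared norm. -/
noncomputable def spectralIntegrand (n : ℕ) (g : SU2) (z : ℂ) :
    (Fin (n + 1) → Fin (n + 1) → ℂ) × ℝ :=
  (fun i j => z * conj (wignerPhi n i j g), ‖z‖ ^ 2)

theorem measurable_spectralIntegrand (n : ℕ) :
    Measurable (Function.uncurry (spectralIntegrand n)) := by
  refine Measurable.prodMk (measurable_pi_lambda _ fun i => measurable_pi_lambda _ fun j => ?_)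
    (measurable_snd.norm.pow_const 2)
  exact measurable_snd.mul ((Complex.continuous_conj.comp
    (continuous_wignerPhi i j)).measurable.comp measurable_fst)

theorem integrable_sq_norm_of_memLp {F : SU2 → ℂ} (hF : MemLp F 2 SU2.vol) :
    Integrable (fun g => ‖F g‖ ^ 2) SU2.vol :=
  (memLp_two_iff_integrable_sq_norm hF.1).1 hF

theorem integrable_spectralIntegrand {F : SU2 → ℂ} (hF : MemLp F 2 SU2.vol) :
    Integrable (fun g => spectralIntegrand n g (F g)) SU2.haar := by
  refine Integrable.prodMk (Integrable.of_eval fun i => Integrable.of_eval fun j => ?_) ?_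
  · exact SU2.integrable_vol_iff.1 (integrable_mul_conj_wignerPhi (hF.integrable one_le_two) i j)
  · exact SU2.integrable_vol_iff.1 (integrable_sq_norm_of_memLp hF)

theorem l2NormSq_eq_ofReal {F : SU2 → ℂ} (hF : MemLp F 2 SU2.vol) :
    l2NormSq F = ENNReal.ofReal (∫ g, ‖F g‖ ^ 2 ∂SU2.vol) := by
  rw [ofReal_integral_eq_lintegral_ofReal (integrable_sq_norm_of_memLp hF)
    (.of_forall fun g => by positivity), l2NormSq]
  simp only [ENNReal.ofReal_pow (norm_nonneg _), ofReal_norm]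

/-- The Fourier coefficients and the squared norm in terms of the integral of the spectral
integrand. -/
theorem spectralData_eq {F : SU2 → ℂ} (hF : MemLp F 2 SU2.vol) :
    (fourierCoef F n, l2NormSq F) =
      (fun p : (Fin (n + 1) → Fin (n + 1) → ℂ) × ℝ =>
        ((16 * Real.pi ^ 2) • p.1, ENNReal.ofReal ((16 * Real.pi ^ 2) * p.2)))
          (∫ g, spectralIntegrand n g (F g) ∂SU2.haar) := by
  have hi := integrable_spectralIntegrand (n := n) hF
  refine Prod.ext ?_ ?_
  · funext i j
    change _ = (16 * Real.pi ^ 2) • (∫ g, spectralIntegrand n g (F g) ∂SU2.haar).1 i j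
    rw [fst_integral hi, eval_integral fun i => hi.fst.eval i,
      eval_integral fun j => (hi.fst.eval i).eval j]
    exact SU2.integral_vol _
  · change _ = ENNReal.ofReal ((16 * Real.pi ^ 2) * (∫ g, spectralIntegrand n g (F g) ∂SU2.haar).2)
    rw [snd_integral hi, l2NormSq_eq_ofReal hF, SU2.integral_vol]
    rfl

/-- The law of the Fourier coefficients of a bi-invariant field is invariant under rotations. -/
theorem identDistrib_rotate [SFinite P] (hX : Measurable (Function.uncurry X))
    (hL : ∀ᵐ ω ∂P, MemLp (X ω) 2 SU2.vol) (hinv : IsBiInvariant P X) (n : ℕ) (a b : SU2) :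
    IdentDistrib (fun ω => (rotate a b (fourierCoef (X ω) n), l2NormSq (X ω)))
      (fun ω => (fourierCoef (X ω) n, l2NormSq (X ω))) P P := by
  have hY := measurable_translate hX a⁻¹ b
  have hLY : ∀ᵐ ω ∂P, MemLp (fun g => X ω (a⁻¹ * g * b)) 2 SU2.vol := by
    filter_upwards [hL] with ω hω using memLp_translate hω a⁻¹ b
  -- A single vector-valued integral holds all coefficients and the norm, so that their joint law is
  -- obtained.
  have h := identDistrib_integral (Q := SU2.haar) hY hX (hinv a b)
    (measurable_spectralIntegrand n)
    (hLY.mono fun ω hω => integrable_spectralIntegrand hω)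
    (hL.mono fun ω hω => integrable_spectralIntegrand hω)
  have hm : Measurable (fun p : (Fin (n + 1) → Fin (n + 1) → ℂ) × ℝ =>
        ((16 * Real.pi ^ 2) • p.1, ENNReal.ofReal ((16 * Real.pi ^ 2) * p.2))) := by
    refine Measurable.prodMk ?_ (measurable_snd.const_mul _).ennreal_ofReal
    refine measurable_pi_lambda _ fun i => measurable_pi_lambda _ fun j => ?_
    have hij : Measurable fun p : (Fin (n + 1) → Fin (n + 1) → ℂ) × ℝ => p.1 i j :=
      (measurable_pi_apply j).comp ((measurable_pi_apply i).comp measurable_fst)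
    exact hij.const_smul (16 * Real.pi ^ 2)
  have hc := h.comp hm
  refine (IdentDistrib.of_ae_eq hc.aemeasurable_fst ?_).symm.trans
    (hc.trans (IdentDistrib.of_ae_eq hc.aemeasurable_snd ?_))
  · filter_upwards [hL, hLY] with ω hω hω'
    refine (spectralData_eq hω').symm.trans ?_
    rw [l2NormSq_translate]
    congr 1
    funext i j
    exact fourierCoef_translate (hω.integrable one_le_two) a b i j
  · filter_upwards [hL] with ω hω
    exact (spectralData_eq hω).symm

end Fields

/-! ### Averaging over rotations -/

section Averaging

variable {Ω : Type*} [MeasurableSpace Ω] {P : Measure Ω} {X : Ω → SU2 → ℂ} {n : ℕ}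

theorem measurable_entry (i j : Fin (n + 1)) :
    Measurable fun A : Fin (n + 1) → Fin (n + 1) → ℂ => A i j :=
  (measurable_pi_apply j).comp (measurable_pi_apply i)

theorem measurable_sum_enorm_sq :
    Measurable fun A : Fin (n + 1) → Fin (n + 1) → ℂ => ∑ k, ∑ l, ‖A k l‖ₑ ^ 2 :=
  Finset.measurable_sum _ fun k _ => Finset.measurable_sum _ fun l _ =>
    (measurable_entry k l).enorm.pow_const 2

theorem measurable_rotate (i j : Fin (n + 1)) :
    Measurable fun p : (Fin (n + 1) → Fin (n + 1) → ℂ) × (SU2 × SU2) =>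
      rotate p.2.1 p.2.2 p.1 i j := by
  refine Finset.measurable_sum _ fun l _ => (Finset.measurable_sum _ fun k _ => ?_).mul ?_
  · exact ((measurable_entry k l).comp measurable_fst).mul ((Complex.continuous_conj.comp
      (continuous_wignerD i k)).measurable.comp (measurable_fst.comp measurable_snd))
  · exact (continuous_wignerD j l).measurable.comp (measurable_snd.comp measurable_snd)

/-- If the weighted mean square of an entry of a random array is invariant under rotations, then
it is a fixed fraction of the weighted mean square norm of the array. -/
theorem lintegral_entry_eq_of_rotate [SFinite P] {A : Ω → Fin (n + 1) → Fin (n + 1) → ℂ}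
    (hA : Measurable A) {r : Ω → ℝ≥0∞} (hr : Measurable r) {i j : Fin (n + 1)}
    (h : ∀ a b, ∫⁻ ω, ‖rotate a b (A ω) i j‖ₑ ^ 2 * r ω ∂P = ∫⁻ ω, ‖A ω i j‖ₑ ^ 2 * r ω ∂P) :
    ∫⁻ ω, ‖A ω i j‖ₑ ^ 2 * r ω ∂P =
      (((n : ℝ≥0∞) + 1)⁻¹) ^ 2 * ∫⁻ ω, (∑ k, ∑ l, ‖A ω k l‖ₑ ^ 2) * r ω ∂P := by
  have hm : Measurable fun q : (SU2 × SU2) × Ω => ‖rotate q.1.1 q.1.2 (A q.2) i j‖ₑ ^ 2 * r q.2 :=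
    (((measurable_rotate i j).comp
      ((hA.comp measurable_snd).prodMk measurable_fst)).enorm.pow_const 2).mul
      (hr.comp measurable_snd)
  -- The expectation is constant along rotations, hence equal to its Haar mean, and Tonelli brings
  -- the mean inside.
  calc ∫⁻ ω, ‖A ω i j‖ₑ ^ 2 * r ω ∂P
      = ∫⁻ p : SU2 × SU2, ∫⁻ ω, ‖rotate p.1 p.2 (A ω) i j‖ₑ ^ 2 * r ω ∂P
          ∂(SU2.haar.prod SU2.haar) := by
        simp only [h, lintegral_const, measure_univ, mul_one]
    _ = ∫⁻ ω, ∫⁻ p : SU2 × SU2, ‖rotate p.1 p.2 (A ω) i j‖ₑ ^ 2 * r ω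
          ∂(SU2.haar.prod SU2.haar) ∂P := lintegral_lintegral_swap hm.aemeasurable
    _ = ∫⁻ ω, (((n : ℝ≥0∞) + 1)⁻¹) ^ 2 * ((∑ k, ∑ l, ‖A ω k l‖ₑ ^ 2) * r ω) ∂P := by
        refine lintegral_congr fun ω => ?_
        have hc : Measurable fun p : SU2 × SU2 => ‖rotate p.1 p.2 (A ω) i j‖ₑ ^ 2 :=
          (continuous_rotate_left (A ω) i j).measurable.enorm.pow_const 2
        rw [lintegral_mul_const _ hc, lintegral_prod _ hc.aemeasurable, lintegral_enorm_rotate_sq,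
          mul_assoc]
    _ = _ := lintegral_const_mul _ ((measurable_sum_enorm_sq.comp hA).mul hr)

theorem measurable_fourierCoef_array (hX : Measurable (Function.uncurry X)) (n : ℕ) :
    Measurable fun ω => fourierCoef (X ω) n :=
  measurable_pi_lambda _ fun i => measurable_pi_lambda _ fun j => measurable_fourierCoef hX i j

/-- For a bi-invariant field, mean squares of Fourier coefficients with a rotation invariant weight
depend on the degree only. -/
theorem lintegral_fourierCoef_of_isBiInvariant [SFinite P] (hX : Measurable (Function.uncurry X))
    (hL : ∀ᵐ ω ∂P, MemLp (X ω) 2 SU2.vol) (hinv : IsBiInvariant P X)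
    {ρ : (Fin (n + 1) → Fin (n + 1) → ℂ) × ℝ≥0∞ → ℝ≥0∞} (hρ : Measurable ρ)
    (hρr : ∀ a b A t, ρ (rotate a b A, t) = ρ (A, t)) (i j : Fin (n + 1)) :
    ∫⁻ ω, ‖fourierCoef (X ω) n i j‖ₑ ^ 2 * ρ (fourierCoef (X ω) n, l2NormSq (X ω)) ∂P =
      (((n : ℝ≥0∞) + 1)⁻¹) ^ 2 * ∫⁻ ω, (∑ k, ∑ l, ‖fourierCoef (X ω) n k l‖ₑ ^ 2) *
        ρ (fourierCoef (X ω) n, l2NormSq (X ω)) ∂P := by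
  have hA := measurable_fourierCoef_array hX n
  refine lintegral_entry_eq_of_rotate hA (hρ.comp (hA.prodMk (measurable_l2NormSq hX)))
    fun a b => ?_
  have h := (identDistrib_rotate hX hL hinv n a b).comp
    (u := fun p => ‖p.1 i j‖ₑ ^ 2 * ρ p)
    ((((measurable_entry i j).comp measurable_fst).enorm.pow_const 2).mul hρ)
  simpa only [Function.comp_def, hρr] using h.lintegral_eq

theorem sum_enorm_sq_ne_top (A : Fin (n + 1) → Fin (n + 1) → ℂ) :
    ∑ k, ∑ l, ‖A k l‖ₑ ^ 2 ≠ ∞ := by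
  simp [ENNReal.sum_eq_top]

theorem sum_enorm_sq_eq_zero_iff (A : Fin (n + 1) → Fin (n + 1) → ℂ) :
    ∑ k, ∑ l, ‖A k l‖ₑ ^ 2 = 0 ↔ A = 0 := by
  simp [Finset.sum_eq_zero_iff, funext_iff]

/-- The expected relative mass of a Fourier coefficient among those of its degree. -/
theorem lintegral_fourierCoef_div_sum [SFinite P] (hX : Measurable (Function.uncurry X))
    (hL : ∀ᵐ ω ∂P, MemLp (X ω) 2 SU2.vol) (hinv : IsBiInvariant P X) (i j : Fin (n + 1)) :
    ∫⁻ ω, ‖fourierCoef (X ω) n i j‖ₑ ^ 2 / ∑ k, ∑ l, ‖fourierCoef (X ω) n k l‖ₑ ^ 2 ∂P =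
      (((n : ℝ≥0∞) + 1)⁻¹) ^ 2 * P {ω | fourierCoef (X ω) n ≠ 0} := by
  have h := lintegral_fourierCoef_of_isBiInvariant hX hL hinv (n := n)
    (ρ := fun p => (∑ k, ∑ l, ‖p.1 k l‖ₑ ^ 2)⁻¹) (measurable_sum_enorm_sq.comp measurable_fst).inv
    (fun a b A t => by rw [sum_enorm_rotate_sq]) i j
  simp only [← div_eq_mul_inv] at h
  rw [h]
  have hms : MeasurableSet {ω | fourierCoef (X ω) n ≠ 0} :=
    (measurable_fourierCoef_array hX n) (measurableSet_singleton 0).compl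
  rw [← lintegral_indicator_one hms]
  congr 1
  refine lintegral_congr fun ω => ?_
  -- The total relative mass is `0 / 0 = 0` on a zero array and `1` otherwise.
  by_cases h0 : fourierCoef (X ω) n = 0
  · simp [h0]
  · rw [Set.indicator_of_mem (show ω ∈ {ω | fourierCoef (X ω) n ≠ 0} from h0)]
    exact ENNReal.div_self (fun h => h0 ((sum_enorm_sq_eq_zero_iff _).1 h)) (sum_enorm_sq_ne_top _)

/-- The expectation of a function of the Fourier coefficients of nonzero right spin vanishes. -/
theorem integral_eq_zero_of_right_spin [SFinite P] (hX : Measurable (Function.uncurry X))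
    (hL : ∀ᵐ ω ∂P, MemLp (X ω) 2 SU2.vol) (hinv : IsBiInvariant P X)
    {f : (Fin (n + 1) → Fin (n + 1) → ℂ) → ℂ} (hf : Measurable f) {r : ℚ} (hr : r ≠ 0)
    (hfr : ∀ A ψ, f (rotate 1 (SU2.g3 ψ) A) = Complex.exp (Complex.I * (r : ℂ) * ψ) * f A) :
    ∫ ω, f (fourierCoef (X ω) n) ∂P = 0 := by
  refine eq_zero_of_eq_exp_mul hr fun ψ => ?_
  have h := ((identDistrib_rotate hX hL hinv n 1 (SU2.g3 ψ)).comp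
    (hf.comp measurable_fst)).integral_eq
  simp only [Function.comp_def, hfr] at h
  rw [integral_const_mul] at h
  exact h.symm

theorem rotate_one_g3 (A : Fin (n + 1) → Fin (n + 1) → ℂ) (ψ : ℝ) (i j : Fin (n + 1)) :
    rotate 1 (SU2.g3 ψ) A i j =
      Complex.exp (Complex.I * ((-spinValue n j : ℚ) : ℂ) * ψ) * A i j := by
  rw [rotate, Finset.sum_eq_single j]
  · rw [wignerD_g3, if_pos rfl, mul_comm]
    simp [wignerD_one, apply_ite]
  · intro l _ hl; rw [wignerD_g3, if_neg hl.symm, mul_zero]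
  · simp

end Averaging

/-! ### Second moments of weakly bi-invariant fields -/

section Weak

variable {Ω : Type*} [MeasurableSpace Ω] {P : Measure Ω} {X : Ω → SU2 → ℂ} {n : ℕ}

theorem integral_conj_mul_self (f : Ω → ℂ) :
    ∫ ω, conj (f ω) * f ω ∂P = ((∫ ω, ‖f ω‖ ^ 2 ∂P : ℝ) : ℂ) := by
  rw [← integral_complex_ofReal]
  simp only [Complex.conj_mul', Complex.ofReal_pow]

/-- Left translations are transitive. The resulting uniform bound on second moments is what
justifies every use of Fubini below. -/
theorem IsTwoWeaklyBiInvariant.integral_norm_sq (h : IsTwoWeaklyBiInvariant P X) (g : SU2) :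
    ∫ ω, ‖X ω g‖ ^ 2 ∂P = ∫ ω, ‖X ω 1‖ ^ 2 ∂P := by
  have := h.corr_conj g 1 1 1
  rw [mul_one, mul_one, integral_conj_mul_self, integral_conj_mul_self] at this
  exact Complex.ofReal_injective this

theorem lintegral_enorm_sq_eq {f : Ω → ℂ} (hf : MemLp f 2 P) :
    ∫⁻ ω, ‖f ω‖ₑ ^ 2 ∂P = ENNReal.ofReal (∫ ω, ‖f ω‖ ^ 2 ∂P) := by
  rw [ofReal_integral_eq_lintegral_ofReal ((memLp_two_iff_integrable_sq_norm hf.1).1 hf)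
    (.of_forall fun g => by positivity)]
  simp only [ENNReal.ofReal_pow (norm_nonneg _), ofReal_norm]

theorem memLp_two_of_lintegral {S : Type*} [MeasurableSpace S] {Q : Measure S} {f : S → ℂ}
    (hf : AEStronglyMeasurable f Q) (h : ∫⁻ s, ‖f s‖ₑ ^ 2 ∂Q < ∞) : MemLp f 2 Q := by
  refine ⟨hf, ?_⟩
  rw [eLpNorm_lt_top_iff_lintegral_rpow_enorm_lt_top two_ne_zero ENNReal.ofNat_ne_top]
  simpa using h

theorem IsTwoWeaklyBiInvariant.lintegral_l2NormSq_lt_top [SFinite P]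
    (hX : Measurable (Function.uncurry X)) (h : IsTwoWeaklyBiInvariant P X) :
    ∫⁻ ω, l2NormSq (X ω) ∂P < ∞ := by
  have hm : Measurable (Function.uncurry fun ω g => ‖X ω g‖ₑ ^ 2) := hX.enorm.pow_const 2
  simp only [l2NormSq]
  rw [lintegral_lintegral_swap hm.aemeasurable]
  simp only [lintegral_enorm_sq_eq (h.memLp _), h.integral_norm_sq, lintegral_const]
  exact ENNReal.mul_lt_top ENNReal.ofReal_lt_top (measure_lt_top _ _)

theorem ae_memLp_of_lintegral_l2NormSq (hX : Measurable (Function.uncurry X))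
    (h : ∫⁻ ω, l2NormSq (X ω) ∂P < ∞) : ∀ᵐ ω ∂P, MemLp (X ω) 2 SU2.vol := by
  filter_upwards [ae_lt_top (measurable_l2NormSq hX) h.ne] with ω hω
  exact memLp_two_of_lintegral (hX.comp measurable_prodMk_left).aestronglyMeasurable hω

section SecondMoment

variable {S : Type*} [MeasurableSpace S] {Q : Measure S} [IsFiniteMeasure Q]
  {Z : Ω → S → ℂ} {K : ℝ}

theorem integral_norm_conj_mul_le {f g : Ω → ℂ} (hf : MemLp f 2 P) (hg : MemLp g 2 P)
    (hfK : ∫ ω, ‖f ω‖ ^ 2 ∂P ≤ K) (hgK : ∫ ω, ‖g ω‖ ^ 2 ∂P ≤ K) :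
    ∫ ω, ‖conj (f ω) * g ω‖ ∂P ≤ K := by
  have hf2 := (memLp_two_iff_integrable_sq_norm hf.1).1 hf
  have hg2 := (memLp_two_iff_integrable_sq_norm hg.1).1 hg
  have hi : Integrable (fun ω => conj (f ω) * g ω) P := hf.star.integrable_mul hg
  calc ∫ ω, ‖conj (f ω) * g ω‖ ∂P ≤ ∫ ω, (‖f ω‖ ^ 2 + ‖g ω‖ ^ 2) / 2 ∂P := by
        refine integral_mono hi.norm ((hf2.add hg2).div_const 2) fun ω => ?_
        simp only [norm_mul, RCLike.norm_conj]
        linarith [two_mul_le_add_sq ‖f ω‖ ‖g ω‖]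
    _ ≤ K := by
        rw [integral_div, integral_add hf2 hg2]
        linarith

/-- The expected absolute value of the product is at most `K` at every pair of points, and `Q` is
finite. -/
theorem integrable_conj_mul_prod [IsFiniteMeasure P] (hZ : Measurable (Function.uncurry Z))
    (hL : ∀ s, MemLp (fun ω => Z ω s) 2 P) (hK : ∀ s, ∫ ω, ‖Z ω s‖ ^ 2 ∂P ≤ K) :
    Integrable (Function.uncurry fun ω (p : S × S) => conj (Z ω p.1) * Z ω p.2)
      (P.prod (Q.prod Q)) := by
  have hm : Measurable (Function.uncurry fun ω (p : S × S) => conj (Z ω p.1) * Z ω p.2) :=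
    (Complex.continuous_conj.measurable.comp
      (hZ.comp (measurable_fst.prodMk (measurable_fst.comp measurable_snd)))).mul
      (hZ.comp (measurable_fst.prodMk (measurable_snd.comp measurable_snd)))
  rw [integrable_prod_iff' hm.aestronglyMeasurable]
  refine ⟨.of_forall fun p => (hL p.1).star.integrable_mul (hL p.2), ?_⟩
  refine Integrable.of_bound (C := K) ?_ (.of_forall fun p => ?_)
  · exact (hm.comp measurable_swap).norm.stronglyMeasurable.integral_prod_right.aestronglyMeasurable
  · rw [Real.norm_of_nonneg (integral_nonneg fun _ => norm_nonneg _)]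
    exact integral_norm_conj_mul_le (hL p.1) (hL p.2) (hK p.1) (hK p.2)

/-- The second moment of the integral of a random field in terms of its covariance function. -/
theorem memLp_integral_and_second_moment [IsFiniteMeasure P] (hZ : Measurable (Function.uncurry Z))
    (hL : ∀ s, MemLp (fun ω => Z ω s) 2 P) (hK : ∀ s, ∫ ω, ‖Z ω s‖ ^ 2 ∂P ≤ K) :
    MemLp (fun ω => ∫ s, Z ω s ∂Q) 2 P ∧
    ((∫ ω, ‖∫ s, Z ω s ∂Q‖ ^ 2 ∂P : ℝ) : ℂ) =
      ∫ p : S × S, ∫ ω, conj (Z ω p.1) * Z ω p.2 ∂P ∂(Q.prod Q) := by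
  have hU := integrable_conj_mul_prod (Q := Q) hZ hL hK
  -- Path by path, the squared modulus of an integral is a double integral; no integrability of the
  -- path is needed.
  have hrep : ∀ ω, ∫ p : S × S, conj (Z ω p.1) * Z ω p.2 ∂(Q.prod Q) =
      conj (∫ s, Z ω s ∂Q) * ∫ s, Z ω s ∂Q := fun ω => by
    rw [← integral_conj, ← integral_prod_mul (fun s => conj (Z ω s))]
  constructor
  · rw [memLp_two_iff_integrable_sq_norm
      (hZ.stronglyMeasurable.integral_prod_right (ν := Q)).aestronglyMeasurable]
    have := hU.integral_prod_left.norm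
    simp only [Function.uncurry_apply_pair, hrep, norm_mul, RCLike.norm_conj, ← sq] at this
    exact this
  · rw [← integral_conj_mul_self, ← integral_integral_swap hU]
    simp only [hrep]

end SecondMoment

/-- The second moment of a Fourier coefficient in terms of the covariance function. -/
theorem memLp_fourierCoef_and_second_moment [IsFiniteMeasure P] {Z : Ω → SU2 → ℂ}
    (hZ : Measurable (Function.uncurry Z)) (hL : ∀ g, MemLp (fun ω => Z ω g) 2 P) {K : ℝ}
    (hK : ∀ g, ∫ ω, ‖Z ω g‖ ^ 2 ∂P ≤ K) (i j : Fin (n + 1)) :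
    MemLp (fun ω => fourierCoef (Z ω) n i j) 2 P ∧
    ((∫ ω, ‖fourierCoef (Z ω) n i j‖ ^ 2 ∂P : ℝ) : ℂ) =
      ∫ p : SU2 × SU2, (∫ ω, conj (Z ω p.1) * Z ω p.2 ∂P) *
        (wignerPhi n i j p.1 * conj (wignerPhi n i j p.2)) ∂(SU2.vol.prod SU2.vol) := by
  obtain ⟨B, hB⟩ := isCompact_univ.exists_bound_of_continuousOn
    (continuous_wignerPhi i j).continuousOn
  have hm : Measurable (Function.uncurry fun ω g => Z ω g * conj (wignerPhi n i j g)) :=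
    hZ.mul ((Complex.continuous_conj.comp (continuous_wignerPhi i j)).measurable.comp measurable_snd)
  have h := memLp_integral_and_second_moment (Q := SU2.vol) (K := K * B ^ 2) hm
    (fun g => (hL g).mul_const _) fun g => by
      simp only [norm_mul, RCLike.norm_conj, mul_pow]
      rw [integral_mul_const]
      have := hK g
      have hK0 : 0 ≤ K := (integral_nonneg fun _ => by positivity).trans this
      have := hB g trivial
      gcongr
  refine ⟨h.1, h.2.trans ?_⟩
  congr 1; funext p
  rw [← integral_mul_const]
  congr 1; funext ω
  simp only [map_mul, Complex.conj_conj]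
  ring

/-- Both second moments are the same integral of a covariance function, and `corr_conj` identifies
the two covariance functions. -/
theorem IsTwoWeaklyBiInvariant.lintegral_fourierCoef_translate [IsFiniteMeasure P]
    (hX : Measurable (Function.uncurry X)) (h : IsTwoWeaklyBiInvariant P X) (a b : SU2)
    (i j : Fin (n + 1)) :
    ∫⁻ ω, ‖fourierCoef (fun g => X ω (a * g * b)) n i j‖ₑ ^ 2 ∂P =
      ENNReal.ofReal (∫ ω, ‖fourierCoef (X ω) n i j‖ ^ 2 ∂P) := by
  have h1 := memLp_fourierCoef_and_second_moment (measurable_translate hX a b)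
    (fun g => h.memLp (a * g * b)) (fun g => (h.integral_norm_sq (a * g * b)).le) i j (n := n)
  have h2 := memLp_fourierCoef_and_second_moment hX h.memLp
    (fun g => (h.integral_norm_sq g).le) i j (n := n)
  rw [lintegral_enorm_sq_eq h1.1]
  congr 1
  apply Complex.ofReal_injective
  rw [h1.2, h2.2]
  simp only [h.corr_conj]

theorem IsTwoWeaklyBiInvariant.lintegral_fourierCoef [IsFiniteMeasure P]
    (hX : Measurable (Function.uncurry X)) (h : IsTwoWeaklyBiInvariant P X) (i j : Fin (n + 1)) :
    ∫⁻ ω, ‖fourierCoef (X ω) n i j‖ₑ ^ 2 ∂P =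
      ENNReal.ofReal (∫ ω, ‖fourierCoef (X ω) n i j‖ ^ 2 ∂P) := by
  simpa using h.lintegral_fourierCoef_translate hX 1 1 i j

/-- Averaging over rotations with weight one requires only the invariance of mean squares, not of
the law. -/
theorem IsTwoWeaklyBiInvariant.lintegral_fourierCoef_eq_sum [IsFiniteMeasure P]
    (hX : Measurable (Function.uncurry X)) (h : IsTwoWeaklyBiInvariant P X) (i j : Fin (n + 1)) :
    ∫⁻ ω, ‖fourierCoef (X ω) n i j‖ₑ ^ 2 ∂P =
      (((n : ℝ≥0∞) + 1)⁻¹) ^ 2 * ∫⁻ ω, ∑ k, ∑ l, ‖fourierCoef (X ω) n k l‖ₑ ^ 2 ∂P := by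
  have hL := ae_memLp_of_lintegral_l2NormSq hX (h.lintegral_l2NormSq_lt_top hX)
  have := lintegral_entry_eq_of_rotate (P := P) (measurable_fourierCoef_array hX n)
    (r := fun _ => 1) measurable_const (i := i) (j := j) fun a b => by
      simp only [mul_one]
      rw [h.lintegral_fourierCoef hX, ← h.lintegral_fourierCoef_translate hX a⁻¹ b]
      refine lintegral_congr_ae ?_
      filter_upwards [hL] with ω hω
      rw [fourierCoef_translate (hω.integrable one_le_two)]
  simpa only [mul_one] using this

end Weak

/-! ### Discrete and uniform measures -/

section Discrete

variable {α ι : Type*} [MeasurableSpace α]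

theorem uniformOn_singleton_of_notMem {s : Set α} (hs : MeasurableSet s) {a : α} (ha : a ∉ s) :
    uniformOn s {a} = 0 := by
  rw [uniformOn, cond_apply hs, Set.inter_singleton_eq_empty.2 ha, measure_empty, mul_zero]

variable [MeasurableSingletonClass α]

theorem sum_smul_dirac_singleton (c : α → ℝ≥0∞) (a : α) :
    (Measure.sum fun k => c k • Measure.dirac k) {a} = c a := by
  rw [Measure.sum_apply _ (measurableSet_singleton a), tsum_eq_single a]
  · simp
  · intro b hb; simp [hb]

theorem uniformOn_range_singleton [Fintype ι] {f : ι → α} (hf : Function.Injective f) (i : ι) :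
    uniformOn (Set.range f) {f i} = (Fintype.card ι : ℝ≥0∞)⁻¹ := by
  have hm : MeasurableSet (Set.range f) := (Set.finite_range f).measurableSet
  have hc : Measure.count (Set.range f) = (Fintype.card ι : ℝ≥0∞) := by
    rw [Measure.count_apply_finite _ (Set.finite_range f),
      ← Set.ncard_eq_toFinset_card _ (Set.finite_range f), ← Set.image_univ,
      Set.ncard_image_of_injective _ hf, Set.ncard_univ, Nat.card_eq_fintype_card]
  rw [uniformOn, cond_apply hm, hc, Set.inter_eq_right.2 (by simp), Measure.count_singleton,
    mul_one]

/-- The factor `c` leaves room for the defective mass `P(X ≠ 0)`. -/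
theorem eq_smul_uniformOn_range [Countable α] [Fintype ι] {f : ι → α}
    (hf : Function.Injective f) {ν : Measure α} {c : ℝ≥0∞}
    (h : ∀ i, ν {f i} = c * (Fintype.card ι : ℝ≥0∞)⁻¹) (h0 : ∀ a, a ∉ Set.range f → ν {a} = 0) :
    ν = c • uniformOn (Set.range f) := by
  refine Measure.ext_of_singleton fun a => ?_
  rw [Measure.smul_apply, smul_eq_mul]
  by_cases ha : a ∈ Set.range f
  · obtain ⟨i, rfl⟩ := ha
    rw [h, uniformOn_range_singleton hf]
  · rw [h0 a ha, uniformOn_singleton_of_notMem (Set.finite_range f).measurableSet ha, mul_zero]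

theorem restrict_range_eq_smul_uniformOn [Countable α] [Fintype ι] [Nonempty ι] {f : ι → α}
    (hf : Function.Injective f) {ν : Measure α} {c : ℝ≥0∞} (h : ∀ i, ν {f i} = c) :
    ν.restrict (Set.range f) = ν (Set.range f) • uniformOn (Set.range f) := by
  have hcard : (Fintype.card ι : ℝ≥0∞) ≠ 0 := by simp
  have hcard' : (Fintype.card ι : ℝ≥0∞) ≠ ∞ := ENNReal.natCast_ne_top _
  have hr : ν.restrict (Set.range f) = (c * Fintype.card ι) • uniformOn (Set.range f) := by
    refine eq_smul_uniformOn_range hf (fun i => ?_) fun a ha => ?_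
    · rw [mul_assoc, ENNReal.mul_inv_cancel hcard hcard', mul_one,
        Measure.restrict_apply (measurableSet_singleton _), Set.inter_eq_left.2 (by simp), h]
    · rw [Measure.restrict_apply (measurableSet_singleton _), Set.singleton_inter_eq_empty.2 ha,
        measure_empty]
  -- Total masses identify `c * card ι` with the mass of the range; `c = ∞` is not excluded.
  have hu := congrArg (fun m => m Set.univ) hr
  have : IsProbabilityMeasure (uniformOn (Set.range f)) :=
    isProbabilityMeasure_uniformOn (Set.finite_range f) (Set.range_nonempty f)
  simp only [Measure.restrict_apply_univ, Measure.smul_apply, measure_univ, smul_eq_mul,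
    mul_one] at hu
  rw [hu, hr]

end Discrete

/-! ### Spectral measures -/

section Spectral

instance : Countable WignerIndex :=
  inferInstanceAs (Countable (Σ n : ℕ, Fin (n + 1) × Fin (n + 1)))

instance : DiscreteMeasurableSpace WignerIndex := ⟨fun _ => trivial⟩

variable {n : ℕ}

/-- The triple `(ℓ, m, s)`, for `n = 2ℓ`. -/
def WignerIndex.mk (n : ℕ) (p : Fin (n + 1) × Fin (n + 1)) : WignerIndex := ⟨n, p⟩

theorem WignerIndex.mk_injective (n : ℕ) : Function.Injective (WignerIndex.mk n) :=
  sigma_mk_injective (β := fun n : ℕ => Fin (n + 1) × Fin (n + 1))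

theorem WignerIndex.range_mk (n : ℕ) : Set.range (WignerIndex.mk n) = WignerIndex.level n := by
  ext k
  constructor
  · rintro ⟨p, rfl⟩; rfl
  · rintro rfl; exact ⟨k.2, rfl⟩

theorem spinSet_prod (n : ℕ) : spinSet n ×ˢ spinSet n =
    Set.range fun p : Fin (n + 1) × Fin (n + 1) => (spinValue n p.1, spinValue n p.2) :=
  Set.range_prodMap.symm

theorem spinValue_prod_injective (n : ℕ) : Function.Injective
    fun p : Fin (n + 1) × Fin (n + 1) => (spinValue n p.1, spinValue n p.2) :=
  (spinValue_injective n).prodMap (spinValue_injective n)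

theorem card_index_inv (n : ℕ) : (Fintype.card (Fin (n + 1) × Fin (n + 1)) : ℝ≥0∞)⁻¹ =
    (((n : ℝ≥0∞) + 1)⁻¹) ^ 2 := by
  rw [Fintype.card_prod, Fintype.card_fin, ← ENNReal.inv_pow, sq]
  push_cast
  rfl

theorem isUniformOnLevels_of_singleton {ν : Measure WignerIndex}
    (h : ∀ n, ∃ c, ∀ p, ν {WignerIndex.mk n p} = c) : IsUniformOnLevels ν := by
  intro n
  obtain ⟨c, hc⟩ := h n
  rw [← WignerIndex.range_mk]
  exact restrict_range_eq_smul_uniformOn (WignerIndex.mk_injective n) hc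

/-- A measure that is carried by the triples of a given degree is a finite sum. -/
theorem sum_smul_dirac_apply_of_level {c : WignerIndex → ℝ≥0∞}
    (hc : ∀ k, k ∉ WignerIndex.level n → c k = 0) (S : Set WignerIndex) :
    (Measure.sum fun k => c k • Measure.dirac k) S =
      ∑ p, c (WignerIndex.mk n p) * S.indicator 1 (WignerIndex.mk n p) := by
  rw [Measure.sum_apply _ (MeasurableSet.of_discrete), ← tsum_fintype (L := .unconditional _),
    (WignerIndex.mk_injective n).tsum_eq (f := fun k => c k * S.indicator 1 k)]
  · refine tsum_congr fun k => ?_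
    rw [Measure.smul_apply, Measure.dirac_apply' _ MeasurableSet.of_discrete, smul_eq_mul]
  · intro k hk
    rw [WignerIndex.range_mk]
    by_contra h
    exact hk (by simp [hc k h])

variable {c : WignerIndex → ℝ≥0∞}

theorem map_right_sum_smul_dirac (hc : ∀ k, k ∉ WignerIndex.level n → c k = 0)
    (j : Fin (n + 1)) :
    ((Measure.sum fun k => c k • Measure.dirac k).map WignerIndex.right) {spinValue n j} =
      ∑ i, c (WignerIndex.mk n (i, j)) := by
  rw [Measure.map_apply (measurable_of_countable _) (measurableSet_singleton _),
    sum_smul_dirac_apply_of_level hc, Fintype.sum_prod_type]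
  refine Finset.sum_congr rfl fun i _ => ?_
  rw [Finset.sum_eq_single j]
  · rw [Set.indicator_of_mem (by rfl), Pi.one_apply, mul_one]
  · intro b _ hb
    rw [Set.indicator_of_notMem, mul_zero]
    exact fun h => hb (spinValue_injective n h)
  · simp

theorem map_right_sum_smul_dirac_of_notMem (hc : ∀ k, k ∉ WignerIndex.level n → c k = 0)
    {s : ℚ} (hs : s ∉ spinSet n) :
    ((Measure.sum fun k => c k • Measure.dirac k).map WignerIndex.right) {s} = 0 := by
  rw [Measure.map_apply (measurable_of_countable _) (measurableSet_singleton _),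
    sum_smul_dirac_apply_of_level hc]
  refine Finset.sum_eq_zero fun p _ => ?_
  rw [Set.indicator_of_notMem, mul_zero]
  exact fun h => hs ⟨p.2, h⟩

theorem map_both_sum_smul_dirac (hc : ∀ k, k ∉ WignerIndex.level n → c k = 0)
    (p : Fin (n + 1) × Fin (n + 1)) :
    ((Measure.sum fun k => c k • Measure.dirac k).map WignerIndex.both)
      {(spinValue n p.1, spinValue n p.2)} = c (WignerIndex.mk n p) := by
  rw [Measure.map_apply (measurable_of_countable _) (measurableSet_singleton _),
    sum_smul_dirac_apply_of_level hc, Finset.sum_eq_single p]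
  · rw [Set.indicator_of_mem (by rfl), Pi.one_apply, mul_one]
  · intro b _ hb
    rw [Set.indicator_of_notMem, mul_zero]
    exact fun h => hb (spinValue_prod_injective n h)
  · simp

theorem map_both_sum_smul_dirac_of_notMem (hc : ∀ k, k ∉ WignerIndex.level n → c k = 0)
    {q : ℚ × ℚ} (hq : q ∉ spinSet n ×ˢ spinSet n) :
    ((Measure.sum fun k => c k • Measure.dirac k).map WignerIndex.both) {q} = 0 := by
  rw [Measure.map_apply (measurable_of_countable _) (measurableSet_singleton _),
    sum_smul_dirac_apply_of_level hc]
  refine Finset.sum_eq_zero fun p _ => ?_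
  rw [Set.indicator_of_notMem, mul_zero]
  intro h
  rw [spinSet_prod] at hq
  exact hq ⟨p, h⟩

theorem spectralMeasure_singleton (F : SU2 → ℂ) (k : WignerIndex) :
    spectralMeasure F {k} = ‖fourierCoef F k.1 k.2.1 k.2.2‖ₑ ^ 2 / l2NormSq F :=
  sum_smul_dirac_singleton _ k

/-! ### The components of a fixed degree -/

section Components

variable {Ω : Type*} {X : Ω → SU2 → ℂ}

theorem fourierCoef_degreePart (ω : Ω) :
    fourierCoef (degreePart X n ω) n = fourierCoef (X ω) n := by
  funext k l; exact fourierCoef_sum_self _ k l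

theorem fourierCoef_degreePart_of_notMem (ω : Ω) {k : WignerIndex} (hk : k ∉ WignerIndex.level n) :
    fourierCoef (degreePart X n ω) k.1 k.2.1 k.2.2 = 0 :=
  fourierCoef_sum_of_ne (fun h => hk h.symm) _ _ _

theorem l2NormSq_degreePart (ω : Ω) :
    l2NormSq (degreePart X n ω) = ∑ i, ∑ j, ‖fourierCoef (X ω) n i j‖ₑ ^ 2 := l2NormSq_sum _

theorem degreePart_eq_zero_iff (ω : Ω) : degreePart X n ω = 0 ↔ fourierCoef (X ω) n = 0 := by
  constructor
  · intro h
    rw [← fourierCoef_degreePart, h]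
    funext i j
    simp [fourierCoef]
  · intro h
    funext g
    simp [degreePart, h]

theorem degreePart_eq_sum_columnPart (ω : Ω) (g : SU2) :
    degreePart X n ω g = ∑ j, columnPart X n j ω g := Finset.sum_comm

theorem SU2.IsSmooth.sum {ι : Type*} {s : Finset ι} {F : ι → SU2 → ℂ} (c : ι → ℂ)
    (hF : ∀ i, SU2.IsSmooth (F i)) : SU2.IsSmooth fun g => ∑ i ∈ s, c i * F i g := by
  choose G hG h using hF
  refine ⟨fun x => ∑ i ∈ s, c i * G i x, ContDiff.sum fun i _ => contDiff_const.mul (hG i), ?_⟩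
  intro g
  simp only [h]

theorem isSmooth_wignerPhi (i j : Fin (n + 1)) : SU2.IsSmooth (wignerPhi n i j) := by
  obtain ⟨G, hG, h⟩ := isSmooth_wignerD i j
  refine ⟨fun x => (Real.sqrt (n + 1) / (4 * Real.pi) : ℝ) * G x, contDiff_const.mul hG, ?_⟩
  intro g
  rw [wignerPhi, h]

theorem columnPart_mem_rightSpinFunctions (j : Fin (n + 1)) (ω : Ω) :
    columnPart X n j ω ∈ rightSpinFunctions (-spinValue n j) := by
  refine ⟨SU2.IsSmooth.sum _ fun i => isSmooth_wignerPhi i j, fun g ψ => ?_⟩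
  simp only [columnPart, wignerPhi, wignerD_mul_g3, Finset.sum_mul]
  exact Finset.sum_congr rfl fun i _ => by ring

/-- A column is the sum attached to an array supported in that column, and orthonormality recovers
the array from its sum. -/
theorem fourierCoef_eq_zero_of_columnPart {ω : Ω} {j : Fin (n + 1)} (h : columnPart X n j ω = 0)
    (i : Fin (n + 1)) : fourierCoef (X ω) n i j = 0 := by
  have := fourierCoef_sum_self (fun k l => if l = j then fourierCoef (X ω) n k j else 0) i j
  rw [if_pos rfl] at this
  rw [← this]
  have h0 : (fun g => ∑ k, ∑ l, (if l = j then fourierCoef (X ω) n k j else 0) *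
      wignerPhi n k l g) = 0 := by
    rw [← h]
    funext g
    simp [columnPart]
  rw [h0]
  simp [fourierCoef]

theorem eq_degreePart_of_mem_wignerSpace {ω : Ω} (h : X ω ∈ wignerSpace n) :
    X ω = degreePart X n ω := eq_sum_fourierCoef_of_mem_wignerSpace h

theorem continuous_degreePart (ω : Ω) : Continuous (degreePart X n ω) :=
  continuous_finsetSum _ fun i _ => continuous_finsetSum _ fun j _ =>
    continuous_const.mul (continuous_wignerPhi i j)

theorem memLp_of_mem_wignerSpace {ω : Ω} (h : X ω ∈ wignerSpace n) : MemLp (X ω) 2 SU2.vol := by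
  have hc : Continuous (X ω) := by
    rw [eq_degreePart_of_mem_wignerSpace h]; exact continuous_degreePart ω
  rw [memLp_two_iff_integrable_sq_norm hc.measurable.aestronglyMeasurable]
  exact (hc.norm.pow 2).integrable_of_su2 _

theorem setOf_degreePart_ne_zero :
    {ω | degreePart X n ω ≠ 0} = {ω | fourierCoef (X ω) n ≠ 0} := by
  ext ω; exact not_congr (degreePart_eq_zero_iff ω)

theorem spectral_weight_degreePart_of_notMem (ω : Ω) (k : WignerIndex)
    (hk : k ∉ WignerIndex.level n) :
    ‖fourierCoef (degreePart X n ω) k.1 k.2.1 k.2.2‖ₑ ^ 2 / l2NormSq (degreePart X n ω) = 0 := by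
  rw [fourierCoef_degreePart_of_notMem ω hk]; simp

end Components

variable {Ω : Type*} [MeasurableSpace Ω] {P : Measure Ω} {X : Ω → SU2 → ℂ}

theorem weakSpectralMeasure_singleton (k : WignerIndex) :
    weakSpectralMeasure P X {k} =
      (∫⁻ ω, ‖fourierCoef (X ω) k.1 k.2.1 k.2.2‖ₑ ^ 2 ∂P) / ∫⁻ ω, l2NormSq (X ω) ∂P :=
  sum_smul_dirac_singleton _ k

theorem strongSpectralMeasure_singleton (k : WignerIndex) :
    strongSpectralMeasure P X {k} =
      ∫⁻ ω, ‖fourierCoef (X ω) k.1 k.2.1 k.2.2‖ₑ ^ 2 / l2NormSq (X ω) ∂P := by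
  rw [strongSpectralMeasure, expectedMeasure, sum_smul_dirac_singleton]
  simp only [spectralMeasure_singleton]

theorem measurable_columnPart (hX : Measurable (Function.uncurry X)) (j : Fin (n + 1)) :
    Measurable (Function.uncurry (columnPart X n j)) := by
  change Measurable fun p : Ω × SU2 => ∑ i, fourierCoef (X p.1) n i j * wignerPhi n i j p.2
  exact Finset.measurable_sum _ fun i _ =>
    ((measurable_fourierCoef hX i j).comp measurable_fst).mul
      ((continuous_wignerPhi i j).measurable.comp measurable_snd)

theorem isRandomSpinWeighted_columnPart (hX : Measurable (Function.uncurry X)) (j : Fin (n + 1)) :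
    IsRandomSpinWeighted P (spinValue n j) (columnPart X n j) :=
  ⟨measurable_columnPart hX j, .of_forall fun ω => columnPart_mem_rightSpinFunctions j ω⟩

/-! ### Strong spectral probabilities -/

theorem isUniformOnLevels_strongSpectralMeasure [SFinite P] (hX : Measurable (Function.uncurry X))
    (hL : ∀ᵐ ω ∂P, MemLp (X ω) 2 SU2.vol) (hinv : IsBiInvariant P X) :
    IsUniformOnLevels (strongSpectralMeasure P X) := by
  refine isUniformOnLevels_of_singleton fun n => ⟨(((n : ℝ≥0∞) + 1)⁻¹) ^ 2 *
    ∫⁻ ω, (∑ k, ∑ l, ‖fourierCoef (X ω) n k l‖ₑ ^ 2) * (l2NormSq (X ω))⁻¹ ∂P, fun p => ?_⟩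
  rw [strongSpectralMeasure_singleton]
  exact lintegral_fourierCoef_of_isBiInvariant hX hL hinv (ρ := fun p => p.2⁻¹)
    measurable_snd.inv (fun _ _ _ _ => rfl) p.1 p.2

theorem expectedBiSpin_degreePart [SFinite P] (hX : Measurable (Function.uncurry X))
    (hL : ∀ᵐ ω ∂P, MemLp (X ω) 2 SU2.vol) (hinv : IsBiInvariant P X) (n : ℕ) :
    expectedBiSpin P (degreePart X n) =
      P {ω | degreePart X n ω ≠ 0} • uniformOn (spinSet n ×ˢ spinSet n) := by
  rw [spinSet_prod, setOf_degreePart_ne_zero]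
  refine eq_smul_uniformOn_range (spinValue_prod_injective n) (fun p => ?_) fun q hq => ?_
  · rw [expectedBiSpin, expectedMeasure, sum_smul_dirac_singleton, card_index_inv, mul_comm,
      ← lintegral_fourierCoef_div_sum hX hL hinv p.1 p.2]
    refine lintegral_congr fun ω => ?_
    rw [biSpinMeasure, spectralMeasure,
      map_both_sum_smul_dirac (spectral_weight_degreePart_of_notMem ω) p, l2NormSq_degreePart]
    change ‖fourierCoef (degreePart X n ω) n p.1 p.2‖ₑ ^ 2 / _ = _
    rw [fourierCoef_degreePart]
  · rw [expectedBiSpin, expectedMeasure, sum_smul_dirac_singleton, ← lintegral_zero]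
    refine lintegral_congr fun ω => ?_
    rw [← spinSet_prod] at hq
    rw [biSpinMeasure, spectralMeasure,
      map_both_sum_smul_dirac_of_notMem (spectral_weight_degreePart_of_notMem ω) hq]

theorem strongSpectralMeasure_degreePart [SFinite P] (hX : Measurable (Function.uncurry X))
    (hL : ∀ᵐ ω ∂P, MemLp (X ω) 2 SU2.vol) (hinv : IsBiInvariant P X) (n : ℕ) :
    strongSpectralMeasure P (degreePart X n) =
      P {ω | degreePart X n ω ≠ 0} • uniformOn (WignerIndex.level n) := by
  rw [← WignerIndex.range_mk, setOf_degreePart_ne_zero]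
  refine eq_smul_uniformOn_range (WignerIndex.mk_injective n) (fun p => ?_) fun k hk => ?_
  · rw [card_index_inv, mul_comm, ← lintegral_fourierCoef_div_sum hX hL hinv p.1 p.2,
      strongSpectralMeasure_singleton]
    refine lintegral_congr fun ω => ?_
    rw [l2NormSq_degreePart]
    change ‖fourierCoef (degreePart X n ω) n p.1 p.2‖ₑ ^ 2 / _ = _
    rw [fourierCoef_degreePart]
  · rw [WignerIndex.range_mk] at hk
    rw [strongSpectralMeasure_singleton]
    simp only [spectral_weight_degreePart_of_notMem _ k hk, lintegral_zero]

theorem expectedRightSpin_degreePart [SFinite P] (hX : Measurable (Function.uncurry X))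
    (hL : ∀ᵐ ω ∂P, MemLp (X ω) 2 SU2.vol) (hinv : IsBiInvariant P X) (n : ℕ) :
    expectedRightSpin P (degreePart X n) =
      P {ω | degreePart X n ω ≠ 0} • uniformOn (spinSet n) := by
  rw [spinSet, setOf_degreePart_ne_zero]
  refine eq_smul_uniformOn_range (spinValue_injective n) (fun j => ?_) fun q hq => ?_
  · have hw : ∀ ω, rightSpinMeasure (degreePart X n ω) {spinValue n j} =
        ∑ i, ‖fourierCoef (X ω) n i j‖ₑ ^ 2 / ∑ k, ∑ l, ‖fourierCoef (X ω) n k l‖ₑ ^ 2 := by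
      intro ω
      rw [rightSpinMeasure, spectralMeasure,
        map_right_sum_smul_dirac (spectral_weight_degreePart_of_notMem ω) j, l2NormSq_degreePart]
      refine Finset.sum_congr rfl fun i _ => ?_
      change ‖fourierCoef (degreePart X n ω) n i j‖ₑ ^ 2 / _ = _
      rw [fourierCoef_degreePart]
    rw [expectedRightSpin, expectedMeasure, sum_smul_dirac_singleton]
    simp only [hw]
    have hm : ∀ i, Measurable fun ω =>
        ‖fourierCoef (X ω) n i j‖ₑ ^ 2 / ∑ k, ∑ l, ‖fourierCoef (X ω) n k l‖ₑ ^ 2 := fun i =>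
      ((measurable_fourierCoef hX i j).enorm.pow_const 2).div
        (measurable_sum_enorm_sq.comp (measurable_fourierCoef_array hX n))
    rw [lintegral_finsetSum _ fun i _ => hm i]
    -- Each of the `n + 1` entries of the column has weight `(n+1)⁻²`, which leaves `(n+1)⁻¹`.
    simp only [lintegral_fourierCoef_div_sum hX hL hinv, Finset.sum_const, Finset.card_univ,
      Fintype.card_fin, nsmul_eq_mul]
    push_cast
    rw [← mul_assoc, sq, ← mul_assoc, ENNReal.mul_inv_cancel (by simp) (by finiteness), one_mul,
      mul_comm]
  · rw [expectedRightSpin, expectedMeasure, sum_smul_dirac_singleton, ← lintegral_zero]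
    refine lintegral_congr fun ω => ?_
    rw [rightSpinMeasure, spectralMeasure,
      map_right_sum_smul_dirac_of_notMem (spectral_weight_degreePart_of_notMem ω) hq]

/-! ### Weak spectral probabilities -/

theorem weakSpectralMeasure_degreePart
    (hc : ∀ i j, ∫⁻ ω, ‖fourierCoef (X ω) n i j‖ₑ ^ 2 ∂P = (((n : ℝ≥0∞) + 1)⁻¹) ^ 2 *
      ∫⁻ ω, ∑ k, ∑ l, ‖fourierCoef (X ω) n k l‖ₑ ^ 2 ∂P)
    (h0 : ∫⁻ ω, ∑ k, ∑ l, ‖fourierCoef (X ω) n k l‖ₑ ^ 2 ∂P ≠ 0)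
    (h1 : ∫⁻ ω, ∑ k, ∑ l, ‖fourierCoef (X ω) n k l‖ₑ ^ 2 ∂P ≠ ∞) :
    weakSpectralMeasure P (degreePart X n) = uniformOn (WignerIndex.level n) := by
  rw [← WignerIndex.range_mk, ← one_smul ℝ≥0∞ (uniformOn _)]
  refine eq_smul_uniformOn_range (WignerIndex.mk_injective n) (fun p => ?_) fun k hk => ?_
  · rw [card_index_inv, one_mul, weakSpectralMeasure_singleton]
    change (∫⁻ ω, ‖fourierCoef (degreePart X n ω) n p.1 p.2‖ₑ ^ 2 ∂P) / _ = _
    simp only [l2NormSq_degreePart, fourierCoef_degreePart]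
    rw [hc, ENNReal.mul_div_cancel_right h0 h1]
  · rw [WignerIndex.range_mk] at hk
    rw [weakSpectralMeasure_singleton]
    simp [fourierCoef_degreePart_of_notMem _ hk]

theorem lintegral_sum_enorm_sq_ne_zero (hX : Measurable (Function.uncurry X))
    (h : ¬ ∀ᵐ ω ∂P, degreePart X n ω = 0) :
    ∫⁻ ω, ∑ k, ∑ l, ‖fourierCoef (X ω) n k l‖ₑ ^ 2 ∂P ≠ 0 := by
  have hm : Measurable fun ω => ∑ k, ∑ l, ‖fourierCoef (X ω) n k l‖ₑ ^ 2 :=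
    measurable_sum_enorm_sq.comp (measurable_fourierCoef_array hX n)
  rw [Ne, lintegral_eq_zero_iff hm]
  intro h'
  refine h (h'.mono fun ω hω => ?_)
  rw [degreePart_eq_zero_iff]
  exact (sum_enorm_sq_eq_zero_iff _).1 hω

theorem weakBiSpinMeasure_degreePart
    (hc : ∀ i j, ∫⁻ ω, ‖fourierCoef (X ω) n i j‖ₑ ^ 2 ∂P = (((n : ℝ≥0∞) + 1)⁻¹) ^ 2 *
      ∫⁻ ω, ∑ k, ∑ l, ‖fourierCoef (X ω) n k l‖ₑ ^ 2 ∂P)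
    (h0 : ∫⁻ ω, ∑ k, ∑ l, ‖fourierCoef (X ω) n k l‖ₑ ^ 2 ∂P ≠ 0)
    (h1 : ∫⁻ ω, ∑ k, ∑ l, ‖fourierCoef (X ω) n k l‖ₑ ^ 2 ∂P ≠ ∞) :
    weakBiSpinMeasure P (degreePart X n) = uniformOn (spinSet n ×ˢ spinSet n) := by
  have hw : ∀ k, k ∉ WignerIndex.level n →
      (∫⁻ ω, ‖fourierCoef (degreePart X n ω) k.1 k.2.1 k.2.2‖ₑ ^ 2 ∂P) /
        ∫⁻ ω, l2NormSq (degreePart X n ω) ∂P = 0 := fun k hk => by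
    simp [fourierCoef_degreePart_of_notMem _ hk]
  rw [spinSet_prod, ← one_smul ℝ≥0∞ (uniformOn _)]
  refine eq_smul_uniformOn_range (spinValue_prod_injective n) (fun p => ?_) fun q hq => ?_
  · rw [card_index_inv, one_mul, weakBiSpinMeasure, weakSpectralMeasure,
      map_both_sum_smul_dirac hw]
    change (∫⁻ ω, ‖fourierCoef (degreePart X n ω) n p.1 p.2‖ₑ ^ 2 ∂P) / _ = _
    simp only [l2NormSq_degreePart, fourierCoef_degreePart]
    rw [hc, ENNReal.mul_div_cancel_right h0 h1]
  · rw [← spinSet_prod] at hq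
    rw [weakBiSpinMeasure, weakSpectralMeasure, map_both_sum_smul_dirac_of_notMem hw hq]

/-! ### Uncorrelated columns -/

theorem memLp_columnPart
    (hA : ∀ i j, MemLp (fun ω => fourierCoef (X ω) n i j) 2 P) (j : Fin (n + 1)) (g : SU2) :
    MemLp (fun ω => columnPart X n j ω g) 2 P :=
  memLp_finsetSum _ fun i _ => (hA i j).mul_const _

/-- For columns of spins `s` and `s'`, the product has right spin `-(s + s')` and the product with a
conjugate has `s - s'`; the two hypotheses on the indices say that neither is zero. -/
theorem areUncorrelated_columnPart [IsFiniteMeasure P] (hX : Measurable (Function.uncurry X))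
    (hL : ∀ᵐ ω ∂P, MemLp (X ω) 2 SU2.vol) (hinv : IsBiInvariant P X)
    (hA : ∀ i j, MemLp (fun ω => fourierCoef (X ω) n i j) 2 P) {j k : Fin (n + 1)} (hjk : j ≠ k)
    (hjk' : spinValue n k ≠ -spinValue n j) :
    AreUncorrelated P (columnPart X n j) (columnPart X n k) := by
  let f : Fin (n + 1) → SU2 → (Fin (n + 1) → Fin (n + 1) → ℂ) → ℂ :=
    fun j g A => ∑ i, A i j * wignerPhi n i j g
  have hf : ∀ j g, Measurable (f j g) := fun j g =>
    Finset.measurable_sum _ fun i _ => (measurable_entry i j).mul_const _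
  have hrot : ∀ j g A ψ, f j g (rotate 1 (SU2.g3 ψ) A) =
      Complex.exp (Complex.I * ((-spinValue n j : ℚ) : ℂ) * ψ) * f j g A := fun j g A ψ => by
    simp only [f, rotate_one_g3, Finset.mul_sum, mul_assoc]
  have hc : Measurable fun z : ℂ => conj z := Complex.continuous_conj.measurable
  have hs : spinValue n j ≠ spinValue n k := fun h => hjk (spinValue_injective n h)
  have hmean : ∀ j g, spinValue n j ≠ 0 → ∫ ω, columnPart X n j ω g ∂P = 0 := fun j g h0 =>
    integral_eq_zero_of_right_spin hX hL hinv (hf j g) (neg_ne_zero.2 h0) (hrot j g)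
  -- Only a column of spin zero can have a nonzero mean, and two distinct spins are not both zero.
  have hmeans : ∀ g h, (∫ ω, columnPart X n j ω g ∂P) = 0 ∨ ∫ ω, columnPart X n k ω h ∂P = 0 := by
    intro g h
    by_cases h0 : spinValue n j = 0
    · exact Or.inr (hmean k h (h0 ▸ hs.symm))
    · exact Or.inl (hmean j g h0)
  refine ⟨memLp_columnPart hA j, memLp_columnPart hA k, fun g h => ?_, fun g h => ?_⟩
  · rw [mul_eq_zero.2 (hmeans g h)]
    refine integral_eq_zero_of_right_spin (f := fun A => f j g A * f k h A)
      (r := -spinValue n j + -spinValue n k) hX hL hinv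
      ((hf j g).mul (hf k h)) (fun h0 => hjk' (by linarith)) fun A ψ => ?_
    rw [hrot, hrot, ← exp_spin_mul]
    ring
  · rw [integral_conj, mul_eq_zero.2 ((hmeans g h).imp_left fun h' => by rw [h', map_zero])]
    refine integral_eq_zero_of_right_spin (f := fun A => conj (f j g A) * f k h A)
      (r := spinValue n j + -spinValue n k) hX hL hinv
      ((hc.comp (hf j g)).mul (hf k h)) (fun h0 => hs (by linarith)) fun A ψ => ?_
    rw [hrot, hrot, ← exp_spin_mul, map_mul, conj_exp_spin, neg_neg]
    ring

end Spectral

/-! ### Replacing a field by an almost surely equal one -/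

section Congr

variable {Ω : Type*} [MeasurableSpace Ω] {P : Measure Ω} {X Y : Ω → SU2 → ℂ}

theorem expectedMeasure_congr {ι : Type*} [MeasurableSpace ι] {ν ν' : Ω → Measure ι}
    (h : ∀ᵐ ω ∂P, ν ω = ν' ω) : expectedMeasure P ν = expectedMeasure P ν' := by
  simp only [expectedMeasure]
  congr 1; funext k
  rw [lintegral_congr_ae (h.mono fun ω hω => by rw [hω])]

theorem strongSpectralMeasure_congr (h : ∀ᵐ ω ∂P, X ω = Y ω) :
    strongSpectralMeasure P X = strongSpectralMeasure P Y :=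
  expectedMeasure_congr (h.mono fun ω hω => by rw [hω])

theorem expectedRightSpin_congr (h : ∀ᵐ ω ∂P, X ω = Y ω) :
    expectedRightSpin P X = expectedRightSpin P Y :=
  expectedMeasure_congr (h.mono fun ω hω => by rw [hω])

theorem weakSpectralMeasure_congr (h : ∀ᵐ ω ∂P, X ω = Y ω) :
    weakSpectralMeasure P X = weakSpectralMeasure P Y := by
  simp only [weakSpectralMeasure]
  rw [lintegral_congr_ae (h.mono fun ω hω => by rw [hω])]
  congr 1; funext k
  rw [lintegral_congr_ae (h.mono fun ω hω => by rw [hω])]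

theorem measure_ne_zero_congr (h : ∀ᵐ ω ∂P, X ω = Y ω) :
    P {ω | X ω ≠ 0} = P {ω | Y ω ≠ 0} :=
  measure_congr (h.mono fun ω hω => by
    change (X ω ≠ 0) = (Y ω ≠ 0)
    rw [hω])

end Congr

/-! ### The main theorem -/

theorem mainTheorem1 {Ω : Type*} [MeasurableSpace Ω] (P : Measure Ω) [IsProbabilityMeasure P]
    (X : Ω → SU2 → ℂ) (hX : Measurable (Function.uncurry X)) :
    -- bi-invariant fields of a fixed degree `n = 2ℓ`
    (∀ n : ℕ, IsBiInvariant P X → (∀ᵐ ω ∂P, X ω ∈ wignerSpace n) →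
      (∀ j : Fin (n + 1), IsRandomSpinWeighted P (spinValue n j) (columnPart X n j)) ∧
      (∀ᵐ ω ∂P, ∀ g, X ω g = ∑ j, columnPart X n j ω g) ∧
      ((¬ ∀ᵐ ω ∂P, X ω = 0) → ∀ j, ¬ ∀ᵐ ω ∂P, columnPart X n j ω = 0) ∧
      (∫⁻ ω, l2NormSq (X ω) ∂P < ∞ → ∀ j k : Fin (n + 1), j ≠ k →
        spinValue n k ≠ -spinValue n j →
        AreUncorrelated P (columnPart X n j) (columnPart X n k)) ∧
      expectedRightSpin P X = P {ω | X ω ≠ 0} • uniformOn (spinSet n) ∧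
      strongSpectralMeasure P X = P {ω | X ω ≠ 0} • uniformOn (WignerIndex.level n) ∧
      (∫⁻ ω, l2NormSq (X ω) ∂P < ∞ → (¬ ∀ᵐ ω ∂P, X ω = 0) →
        weakSpectralMeasure P X = uniformOn (WignerIndex.level n))) ∧
    -- `2`-weakly bi-invariant fields
    (IsTwoWeaklyBiInvariant P X →
      IsUniformOnLevels (weakSpectralMeasure P X) ∧
      ∀ n : ℕ, (¬ ∀ᵐ ω ∂P, degreePart X n ω = 0) →
        weakBiSpinMeasure P (degreePart X n) = uniformOn (spinSet n ×ˢ spinSet n)) ∧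
    -- bi-invariant fields that are almost surely square integrable
    (IsBiInvariant P X → (∀ᵐ ω ∂P, MemLp (X ω) 2 SU2.vol) →
      IsUniformOnLevels (strongSpectralMeasure P X) ∧
      ∀ n : ℕ, expectedBiSpin P (degreePart X n) =
        P {ω | degreePart X n ω ≠ 0} • uniformOn (spinSet n ×ˢ spinSet n)) := by
  refine ⟨fun n hinv hn => ?_, fun hw => ⟨?_, fun n hne => ?_⟩, fun hinv hL =>
    ⟨isUniformOnLevels_strongSpectralMeasure hX hL hinv, expectedBiSpin_degreePart hX hL hinv⟩⟩
  · have hL : ∀ᵐ ω ∂P, MemLp (X ω) 2 SU2.vol := hn.mono fun ω hω => memLp_of_mem_wignerSpace hω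
    have hXd : ∀ᵐ ω ∂P, X ω = degreePart X n ω :=
      hn.mono fun ω hω => eq_degreePart_of_mem_wignerSpace hω
    have hzero : (¬ ∀ᵐ ω ∂P, X ω = 0) → ¬ ∀ᵐ ω ∂P, degreePart X n ω = 0 := fun h h' =>
      h (by filter_upwards [hXd, h'] with ω h1 h2 using h1.trans h2)
    have hnorm : ∫⁻ ω, l2NormSq (X ω) ∂P =
        ∫⁻ ω, ∑ k, ∑ l, ‖fourierCoef (X ω) n k l‖ₑ ^ 2 ∂P :=
      lintegral_congr_ae (hXd.mono fun ω hω => by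
        beta_reduce
        rw [← l2NormSq_degreePart, ← hω])
    have hsq : ∀ i j, ∫⁻ ω, ‖fourierCoef (X ω) n i j‖ₑ ^ 2 ∂P = (((n : ℝ≥0∞) + 1)⁻¹) ^ 2 *
        ∫⁻ ω, ∑ k, ∑ l, ‖fourierCoef (X ω) n k l‖ₑ ^ 2 ∂P := fun i j => by
      simpa only [mul_one] using lintegral_fourierCoef_of_isBiInvariant hX hL hinv
        (ρ := fun _ => 1) measurable_const (fun _ _ _ _ => rfl) i j
    refine ⟨isRandomSpinWeighted_columnPart hX, ?_, fun hne j hj => ?_, fun hfin j k hjk hjk' => ?_,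
      ?_, ?_, fun hfin hne => ?_⟩
    · filter_upwards [hXd] with ω hω g
      rw [← degreePart_eq_sum_columnPart, ← hω]
    -- A single entry suffices: if column `j` is null, the expected relative mass `(n+1)⁻² P(A ≠ 0)`
    -- of its entry in row `0` is zero, so the whole array is almost surely zero.
    · have h0 := lintegral_fourierCoef_div_sum hX hL hinv (n := n) 0 j
      rw [lintegral_congr_ae (g := fun _ => 0) (hj.mono fun ω hω => by
        simp [fourierCoef_eq_zero_of_columnPart hω 0]), lintegral_zero, eq_comm, mul_eq_zero,
        ← setOf_degreePart_ne_zero] at h0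
      refine hzero hne (h0.resolve_left ?_)
      exact pow_ne_zero _ (ENNReal.inv_ne_zero.2 (by finiteness))
    · refine areUncorrelated_columnPart hX hL hinv (fun i l => ?_) hjk hjk'
      refine memLp_two_of_lintegral (measurable_fourierCoef hX i l).aestronglyMeasurable ?_
      rw [hsq, ← hnorm]
      refine ENNReal.mul_lt_top ?_ hfin
      exact ENNReal.pow_lt_top (ENNReal.inv_lt_top.2 (by positivity))
    · rw [expectedRightSpin_congr hXd, expectedRightSpin_degreePart hX hL hinv,
        measure_ne_zero_congr hXd]
    · rw [strongSpectralMeasure_congr hXd, strongSpectralMeasure_degreePart hX hL hinv,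
        measure_ne_zero_congr hXd]
    · rw [weakSpectralMeasure_congr hXd]
      exact weakSpectralMeasure_degreePart hsq
        (lintegral_sum_enorm_sq_ne_zero hX (hzero hne)) (hnorm ▸ hfin.ne)
  · refine isUniformOnLevels_of_singleton fun n => ⟨(((n : ℝ≥0∞) + 1)⁻¹) ^ 2 *
      (∫⁻ ω, ∑ k, ∑ l, ‖fourierCoef (X ω) n k l‖ₑ ^ 2 ∂P) / ∫⁻ ω, l2NormSq (X ω) ∂P,
      fun p => ?_⟩
    rw [weakSpectralMeasure_singleton, ← hw.lintegral_fourierCoef_eq_sum hX p.1 p.2]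
    rfl
  · refine weakBiSpinMeasure_degreePart (hw.lintegral_fourierCoef_eq_sum hX)
      (lintegral_sum_enorm_sq_ne_zero hX hne) ?_
    have hm : ∀ k l, Measurable fun ω => ‖fourierCoef (X ω) n k l‖ₑ ^ 2 := fun k l =>
      (measurable_fourierCoef hX k l).enorm.pow_const 2
    rw [lintegral_finsetSum _ fun k _ => Finset.measurable_sum _ fun l _ => hm k l]
    simp only [lintegral_finsetSum _ fun l _ => hm _ l, hw.lintegral_fourierCoef hX]
    simp [ENNReal.sum_eq_top]
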